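/- Let $G$ be a connected non-compact simple Lie group with Lie algebra $\mathfrak g$ and Killing form $B$, and let $K$ be a maximal compact subgroup of $G$ with Lie algebra $\mathfrak k$. Let $\mathfrak p$ be the $B$-orthogonal complement of $\mathfrak k$, and assume that $\mathfrak g=\mathfrak p\oplus\mathfrak k$ is a Cartan decomposition, that is, $B$ is negative-definite on $\mathfrak k$ and positive-definite on $\mathfrak p$, and $[\mathfrak p,\mathfrak p]\subset\mathfrak k$ (this holds whenever $G$ has finite centre). Put $Q=B|_{\mathfrak p}-B|_{\mathfrak k}$. Left-invariant tensors on $G$ are identified with the forms they induce on $\mathfrak g$; in particular, for a subspace $\mathfrak u$ among the summands below, $Q|_{\mathfrak u}$ stands for the form on $\mathfrak g$ extended by $0$ to the other summands. Let $r$ be the number of simple ideals of $[\mathfrak k,\mathfrak k]$, and let $s=0$ if the centre of $\mathfrak k$ is trivial and $s=1$ otherwise. Assume that $r+s=2$, and let $\mathfrak k_1,\mathfrak k_2$ be the simple ideals of $[\mathfrak k,\mathfrak k]$ if $r=2$, and the simple ideal of $[\mathfrak k,\mathfrak k]$ and the centre of $\mathfrak k$, in this order, if $r=s=1$. Then $\mathfrak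 k=\mathfrak k_1\oplus\mathfrak k_2$. Let $n=\dim\mathfrak p$ and $d_i=\dim\mathfrak k_i$. There are $\kappa_1,\kappa_2\in\mathbb R$ such that the Killing form of $\mathfrak k_i$ equals $\kappa_iB|_{\mathfrak k_i}$ for $i=1,2$. The group $G\times K$ acts on $G$ by $(x,k)\,y=xyk^{-1}$. Let $\mathcal M_K$ be the set of left-invariant Riemannian metrics on $G$ that are naturally reductive with respect to $G\times K$ and some decomposition of the Lie algebra of $G\times K$. Let $S$ be the scalar curvature functional on $\mathcal M_K$. Given $T_{\mathfrak p},T_1,T_2>0$, let $$T=-T_{\mathfrak p}Q|_{\mathfrak p}+T_1Q|_{\mathfrak k_1}+T_2Q|_{\mathfrak k_2},\qquad \mathcal M_T^0=\{g\in\mathcal M_K : \operatorname{tr}_gT=0\}.$$ Set $$a=nd_2(1-\kappa_2)T_{\mathfrak p},\qquad b=d_1^2(1-\kappa_1)T_1-d_2^2(1-\kappa_2)T_2+2n^2T_{\mathfrak p}-\frac{n^2\kappa_1T_{\mathfrak p}^2}{T_1},$$ $$c=-2nd_2T_2+\frac{2nd_2\kappa_1T_{\mathfrak p}T_2}{T_1}-nd_2\kappa_2T_{\mathfrak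 p},\qquad d=-\frac{d_2^2\kappa_1T_2^2}{T_1}+\kappa_2d_2^2T_2,$$ let $D=18abcd-4b^3d+b^2c^2-4ac^3-27a^2d^2$ be the discriminant of $P(x)=ax^3+bx^2+cx+d$, and let $$R_t=-\frac b{3a},\qquad R_d=\frac{9ad-bc}{2(b^2-3ac)},\qquad R_s=\frac{4abc-9a^2d-b^3}{a(b^2-3ac)},$$ where $R_d$ and $R_s$ are considered only if $b^2\ne3ac$. Then $S|_{\mathcal M_T^0}$ does not have a global minimum. It has: 1. a saddle (a critical point each neighbourhood of which contains points with smaller and points with larger values of $S$) if and only if $D=0$, $b^2=3ac$ and $\frac{d_2T_2}{nT_{\mathfrak p}}<R_t$; 2. a global maximum if and only if $D=0$, $b^2\ne3ac$ and $R_s\le\frac{d_2T_2}{nT_{\mathfrak p}}<R_d$; 3. a local maximum that is not a global maximum if and only if $D=0$, $b^2\ne3ac$ and $\frac{d_2T_2}{nT_{\mathfrak p}}<R_s<R_d$; 4. a local minimum if and only if $D=0$, $b^2\ne3ac$ and $\frac{d_2T_2}{nT_{\mathfrak p}}<R_d<R_s$. Any two critical points of $S|_{\mathcal M_T^0}$ are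 equal up to scaling by a positive constant. -/

import Mathlib

open scoped Manifold ContDiff Topology
open Filter Set

noncomputable section

namespace NatRed

/-! ### Left-invariant metrics on a Lie group, as inner products on its Lie algebra -/

section Metrics

variable (L : Type*) [LieRing L] [LieAlgebra ℝ L]

/-- A left-invariant Riemannian metric on a Lie group, identified with the inner product that it
induces on the Lie algebra `L`. -/
structure InvMetric where
  /-- the bilinear form -/
  form : LinearMap.BilinForm ℝ L
  symm : ∀ X Y, form X Y = form Y X
  pos : ∀ X, X ≠ 0 → 0 < form X X

variable {L}

namespace InvMetric

/-- The topology of pointwise convergence of bilinear forms; if `L` is finite-dimensional, this is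
the usual topology of a set of bilinear forms. -/
instance : TopologicalSpace (InvMetric L) :=
  TopologicalSpace.induced (fun g : InvMetric L => fun X Y : L => g.form X Y) inferInstance

theorem eq_zero_of_form (g : InvMetric L) {X : L} (h : ∀ Z, g.form X Z = 0) : X = 0 := by
  by_contra hX
  exact (g.pos X hX).ne' (h X)

theorem nondegenerate (g : InvMetric L) : g.form.Nondegenerate :=
  ⟨fun _ h => g.eq_zero_of_form h, fun X h => g.eq_zero_of_form (X := X) fun Z => by
    rw [g.symm]; exact h Z⟩

variable [FiniteDimensional ℝ L] (g : InvMetric L)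

/-- The metric isomorphism from covectors to vectors. -/
def sharp : Module.Dual ℝ L ≃ₗ[ℝ] L := (LinearMap.BilinForm.toDual g.form g.nondegenerate).symm

theorem form_sharp (f : Module.Dual ℝ L) (Z : L) : g.form (g.sharp f) Z = f Z := by
  rw [← LinearMap.BilinForm.toDual_def g.nondegenerate]
  simp [sharp]

/-- The trace `tr_g h` of a bilinear form `h` with respect to the inner product `g`. -/
def tr (h : LinearMap.BilinForm ℝ L) : ℝ :=
  LinearMap.trace ℝ L (g.sharp.toLinearMap ∘ₗ h)

/-- The right-hand side of the Koszul formula for left-invariant vector fields, as a functional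
of the third argument. -/
def koszul : L →ₗ[ℝ] L →ₗ[ℝ] Module.Dual ℝ L :=
  LinearMap.mk₂ ℝ
    (fun X Y =>
      { toFun := fun Z =>
          (1 / 2 : ℝ) * (g.form ⁅X, Y⁆ Z - g.form ⁅Y, Z⁆ X + g.form ⁅Z, X⁆ Y)
        map_add' := fun Z W => by simp; ring
        map_smul' := fun c Z => by simp; ring })
    (fun X X' Y => by ext Z; simp; ring)
    (fun c X Y => by ext Z; simp; ring)
    (fun X Y Y' => by ext Z; simp; ring)
    (fun c X Y => by ext Z; simp; ring)

/-- The Levi-Civita connection of the left-invariant metric `g`, on left-invariant vector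
fields. -/
def nabla : L →ₗ[ℝ] L →ₗ[ℝ] L := (koszul g).compr₂ g.sharp.toLinearMap

theorem form_nabla (X Y Z : L) : g.form (g.nabla X Y) Z =
    (1 / 2 : ℝ) * (g.form ⁅X, Y⁆ Z - g.form ⁅Y, Z⁆ X + g.form ⁅Z, X⁆ Y) := by
  simp only [nabla, LinearMap.compr₂_apply, LinearEquiv.coe_coe, form_sharp]
  rfl

/-- The connection is torsion-free. -/
theorem nabla_torsion_free (X Y : L) : g.nabla X Y - g.nabla Y X = ⁅X, Y⁆ := by
  rw [← sub_eq_zero]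
  refine g.eq_zero_of_form fun Z => ?_
  simp only [map_sub, LinearMap.sub_apply, form_nabla]
  rw [← lie_skew Y X, ← lie_skew Y Z, ← lie_skew Z X]
  simp only [map_neg, LinearMap.neg_apply]
  ring

/-- The connection is compatible with the metric. -/
theorem nabla_metric (X Y Z : L) :
    g.form (g.nabla X Y) Z + g.form Y (g.nabla X Z) = 0 := by
  rw [g.symm Y, form_nabla, form_nabla, ← lie_skew Y X, ← lie_skew Y Z, ← lie_skew Z X]
  simp only [map_neg, LinearMap.neg_apply]
  ring

/-- The endomorphism `X ↦ R(X, Y) Z`, with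
`R(X, Y) Z = ∇_X ∇_Y Z - ∇_Y ∇_X Z - ∇_[X,Y] Z`. -/
def curvEnd (Y Z : L) : L →ₗ[ℝ] L where
  toFun X := g.nabla X (g.nabla Y Z) - g.nabla Y (g.nabla X Z) - g.nabla ⁅X, Y⁆ Z
  map_add' X X' := by simp; abel
  map_smul' c X := by simp [smul_sub]

/-- The Ricci curvature `Ric(Y, Z) = tr (X ↦ R(X, Y) Z)`. -/
def ricci : LinearMap.BilinForm ℝ L :=
  LinearMap.mk₂ ℝ (fun Y Z => LinearMap.trace ℝ L (g.curvEnd Y Z))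
    (fun Y Y' Z => by rw [← map_add]; congr 1; ext X; simp [curvEnd]; abel)
    (fun c Y Z => by rw [← map_smul]; congr 1; ext X; simp [curvEnd, smul_sub])
    (fun Y Z Z' => by rw [← map_add]; congr 1; ext X; simp [curvEnd]; abel)
    (fun c Y Z => by rw [← map_smul]; congr 1; ext X; simp [curvEnd, smul_sub])

/-- The scalar curvature functional. -/
def scal : ℝ := g.tr g.ricci

end InvMetric

/-- `g` is a critical point of the restriction of `S` to the set (submanifold) `M` of metrics: the
derivative of `S` along every smooth curve in `M` through `g` vanishes. -/
def IsCriticalPointOn (S : InvMetric L → ℝ) (M : Set (InvMetric L)) (g : InvMetric L) : Prop :=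
  g ∈ M ∧ ∀ γ : ℝ → InvMetric L, γ 0 = g →
    (∀ X Y : L, ContDiffAt ℝ ∞ (fun t => (γ t).form X Y) 0) → (∀ᶠ t in 𝓝 0, γ t ∈ M) →
    HasDerivAt (fun t => S (γ t)) 0 0

/-- `g` is a saddle point of the restriction of `S` to `M`: a critical point such that each of its
neighbourhoods in `M` has points where `S` is smaller, and points where it is larger, than at
`g`. -/
def IsSaddlePointOn (S : InvMetric L → ℝ) (M : Set (InvMetric L)) (g : InvMetric L) : Prop :=
  IsCriticalPointOn S M g ∧ (∃ᶠ h in 𝓝[M] g, S h < S g) ∧ (∃ᶠ h in 𝓝[M] g, S g < S h)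

end Metrics

/-! ### The pair `(𝔤, 𝔨)` -/

section Pairs

variable {L : Type*} [LieRing L] [LieAlgebra ℝ L] (𝔨 : LieSubalgebra ℝ L)

/-- The orthogonal complement `𝔭` of `𝔨` with respect to the Killing form `B`. -/
def complP : Submodule ℝ L := (killingForm ℝ L).orthogonal 𝔨.toSubmodule

/-- `L = 𝔭 ⊕ 𝔨` is a Cartan decomposition. (The inclusions `[𝔨, 𝔨] ⊆ 𝔨` and `[𝔨, 𝔭] ⊆ 𝔭`, and the
fact that the sum is direct and equal to `L`, follow.) -/
structure IsCartanDecomposition : Prop where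
  neg_on_k : ∀ X ∈ 𝔨, X ≠ 0 → killingForm ℝ L X X < 0
  pos_on_p : ∀ X ∈ complP 𝔨, X ≠ 0 → 0 < killingForm ℝ L X X
  lie_p_p : ∀ X ∈ complP 𝔨, ∀ Y ∈ complP 𝔨, ⁅X, Y⁆ ∈ 𝔨

/-- `𝔣 0, …, 𝔣 (m - 1)` lists, without repetition, the simple ideals of `𝔨` and, in the last
place, the centre of `𝔨` in case it is not trivial. As `𝔨` is reductive, its simple ideals are the
simple ideals of `[𝔨, 𝔨]`, so that `m = r + s` if there are `r` of them, and `s` is `0` or `1`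
according to whether the centre is trivial or not. -/
structure IsIdealDecomposition {m : ℕ} (𝔣 : Fin m → LieIdeal ℝ 𝔨) : Prop where
  injective : Function.Injective 𝔣
  mem_range : ∀ I : LieIdeal ℝ 𝔨, I ∈ Set.range 𝔣 ↔
    LieAlgebra.IsSimple ℝ I ∨ (I = LieAlgebra.center ℝ 𝔨 ∧ LieAlgebra.center ℝ 𝔨 ≠ ⊥)
  center_last : ∀ i j : Fin m, 𝔣 i = LieAlgebra.center ℝ 𝔨 → j ≤ i

variable {𝔨} in
/-- The bilinear form `h` on `L = 𝔭 ⊕ 𝔣 0 ⊕ ⋯ ⊕ 𝔣 (m - 1)` equals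
`u Q|_𝔭 + v 0 Q|_(𝔣 0) + ⋯ + v (m - 1) Q|_(𝔣 (m - 1))`, where `Q` is the Killing form `B` on `𝔭`
and `-B` on `𝔨`. -/
def HasBlockForm {m : ℕ} (𝔣 : Fin m → LieIdeal ℝ 𝔨) (h : LinearMap.BilinForm ℝ L)
    (u : ℝ) (v : Fin m → ℝ) : Prop :=
  ∀ X ∈ complP 𝔨, ∀ X' ∈ complP 𝔨, ∀ Y Y' : (i : Fin m) → 𝔣 i,
    h (X + ∑ i, ((Y i : 𝔨) : L)) (X' + ∑ i, ((Y' i : 𝔨) : L)) =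
      u * killingForm ℝ L X X' + ∑ i, v i * -killingForm ℝ L ((Y i : 𝔨) : L) ((Y' i : 𝔨) : L)

/-- The differential `L × 𝔨 → L` at the identity of the orbit map `(x, k) ↦ x k⁻¹` of the action
`(x, k) y = x y k⁻¹` of `G × K` on `G`. -/
def orbitMap : (L × 𝔨) →ₗ[ℝ] L :=
  LinearMap.fst ℝ L 𝔨 - 𝔨.toSubmodule.subtype ∘ₗ LinearMap.snd ℝ L 𝔨

/-- The isotropy subalgebra `{(Z, Z) | Z ∈ 𝔨}` of `L × 𝔨` at the identity of `G`. -/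
def isotropy : Submodule ℝ (L × 𝔨) :=
  LinearMap.range (LinearMap.prod 𝔨.toSubmodule.subtype (LinearMap.id : 𝔨 →ₗ[ℝ] 𝔨))

/-- The left-invariant metric `g` is naturally reductive with respect to `G × K` and the
decomposition `L × 𝔨 = isotropy 𝔨 ⊕ 𝔪` of the Lie algebra of `G × K`: the group `G × K` acts by
isometries, the decomposition is reductive, and
`⟨[u, v]_𝔪, w⟩ + ⟨v, [u, w]_𝔪⟩ = 0` for `u, v, w ∈ 𝔪`, where `⟨·, ·⟩` is the inner product that
`orbitMap 𝔨` induces on `𝔪` from `g`. As `orbitMap 𝔨` vanishes on `isotropy 𝔨`, it takes the same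
value at `[u, v]_𝔪` as at `[u, v]`. -/
structure IsNaturallyReductive (g : InvMetric L) (𝔪 : Submodule ℝ (L × 𝔨)) : Prop where
  isometric : ∀ (Z : 𝔨) (X Y : L), g.form ⁅(Z : L), X⁆ Y + g.form X ⁅(Z : L), Y⁆ = 0
  isCompl : IsCompl (isotropy 𝔨) 𝔪
  reductive : ∀ Z : 𝔨, ∀ u ∈ 𝔪, ⁅(((Z : L), Z) : L × 𝔨), u⁆ ∈ 𝔪
  natural : ∀ u ∈ 𝔪, ∀ v ∈ 𝔪, ∀ w ∈ 𝔪,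
    g.form (orbitMap 𝔨 ⁅u, v⁆) (orbitMap 𝔨 w) + g.form (orbitMap 𝔨 v) (orbitMap 𝔨 ⁅u, w⁆) = 0

/-- The set `M_K` of left-invariant metrics that are naturally reductive with respect to `G × K`
and some decomposition of the Lie algebra of `G × K`. -/
def metricsMK : Set (InvMetric L) := {g | ∃ 𝔪, IsNaturallyReductive 𝔨 g 𝔪}

/-- The set `M_T^0` of metrics in `M_K` with `tr_g T = 0`. -/
def metricsMT0 [FiniteDimensional ℝ L] (T : LinearMap.BilinForm ℝ L) : Set (InvMetric L) :=
  {g | g ∈ metricsMK 𝔨 ∧ g.tr T = 0}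

end Pairs

/-! ### Lie groups -/

section Groups

variable {N : ℕ} {G : Type*} [TopologicalSpace G] [ChartedSpace (EuclideanSpace ℝ (Fin N)) G]
  [Group G]

instance : FiniteDimensional ℝ (GroupLieAlgebra (𝓡 N) G) :=
  inferInstanceAs (FiniteDimensional ℝ (EuclideanSpace ℝ (Fin N)))

instance [LieGroup (𝓡 N) ∞ G] : LieGroup (𝓡 N) (minSmoothness ℝ 3) G :=
  LieGroup.of_le (n := ∞) (by
    rw [minSmoothness_of_isRCLikeNormedField]; exact WithTop.coe_le_coe.2 le_top)

/-- `K` is a maximal compact subgroup of `G`. -/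
def IsMaximalCompact (K : Subgroup G) : Prop :=
  Maximal (fun K' : Subgroup G => IsCompact (K' : Set G)) K

/-- `𝔨` is the Lie algebra of the closed subgroup `K` of `G`: it consists of those `X` for which
`exp (t X) ∈ K` for all real `t`, where `t ↦ exp (t X)` is the integral curve through `1` of the
left-invariant vector field given by `X`. -/
def IsLieAlgebraOf [LieGroup (𝓡 N) ∞ G] (𝔨 : LieSubalgebra ℝ (GroupLieAlgebra (𝓡 N) G))
    (K : Subgroup G) : Prop :=
  ∀ X : GroupLieAlgebra (𝓡 N) G, X ∈ 𝔨 ↔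
    ∃ γ : ℝ → G, γ 0 = 1 ∧ IsMIntegralCurve (I := 𝓡 N) γ (mulInvariantVectorField X) ∧
      ∀ t, γ t ∈ K

end Groups

/-! ### The cubic polynomial `P(x) = a x³ + b x² + c x + d` -/

/-- The discriminant of `a x³ + b x² + c x + d`. -/
def discrD (a b c d : ℝ) : ℝ :=
  18 * a * b * c * d - 4 * b ^ 3 * d + b ^ 2 * c ^ 2 - 4 * a * c ^ 3 - 27 * a ^ 2 * d ^ 2

/-- The special root `R_t`. -/
def rootRt (a b : ℝ) : ℝ := -b / (3 * a)

/-- The special root `R_d`. -/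
def rootRd (a b c d : ℝ) : ℝ := (9 * a * d - b * c) / (2 * (b ^ 2 - 3 * a * c))

/-- The special root `R_s`. -/
def rootRs (a b c d : ℝ) : ℝ :=
  (4 * a * b * c - 9 * a ^ 2 * d - b ^ 3) / (a * (b ^ 2 - 3 * a * c))

end NatRed

end

/-! The metrics in `M_K` are exactly the forms `x Q|_𝔭 + y₁ Q|_𝔨₁ + y₂ Q|_𝔨₂` with positive
coefficients (`mem_metricsMK_iff`). That nothing else occurs is Schur's lemma: because the Lie
algebra is simple, `𝔭` and both ideals are irreducible modules (`eq_complP_of_invariant`,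
`eq_top_of_invariant`), and there are no mixed terms between `𝔭` and one ideal because the other
ideal commutes with it but acts faithfully on `𝔭`. Conversely, `orbitSection` gives an explicit
reductive complement for each such metric. Only the Casimir sums `κ` and `1 - κ` of the ideals enter
the scalar curvature, which becomes a rational function of `x, y₁, y₂` (`AdaptedBasis.scal_eq`).

Put `s = y₂ / x` and `w = d₂ T₂ / (n T_𝔭)`. The condition `tr_g T = 0` reads `d₁ T₁ x / y₁ = n T_𝔭
(1 - w / s)`, so it is solved by arbitrary `x > 0` and `s > w`. In the coordinates `x = exp α`, `s =
w + exp β` one finds `S = exp (-α) G(β)` with `G = -P(s) / (4 n T_𝔭 s (s - w))`. Vanishing of the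
derivative in `α` forces `G = 0`, and then vanishing of the derivative in `β` forces `P'(s) = 0`: a
critical point is a double root of the cubic `P` to the right of `w`.

The decisive fact is `P(w) > 0` (`P_w_pos`). As the leading coefficient is positive, a double root
beyond `w` leaves the third root to the left of `w`. Then `P ≥ 0` on `(w, ∞)`, so `S ≤ 0`, with
equality only on one ray of homothetic metrics. Hence every critical point and every local extremum
is a global maximum, unique up to scaling; saddles, local minima and local maxima that are not
global do not exist. The numerical conditions paired with them cannot hold either: a triple root
beyond `w` would make `P(w)` negative, and `R_s < w` whenever `D = 0` and `b² ≠ 3ac`. In that case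
`R_d` is the double root, which gives the criterion for a global maximum. There is no global minimum
since `G` takes negative values and `α → -∞` drives `S` to `-∞`. -/

noncomputable section

namespace NatRed

/-! ### Bilinear forms and orthonormal bases -/

section Forms

variable {V : Type*} [AddCommGroup V] [Module ℝ V]

/-- The basis `b` is orthonormal with respect to the bilinear form `q`. -/
def IsOrthonormalFor {ι : Type*} [DecidableEq ι] (q : LinearMap.BilinForm ℝ V)
    (b : Module.Basis ι ℝ V) : Prop :=
  ∀ i j, q (b i) (b j) = if i = j then 1 else 0

namespace IsOrthonormalFor

variable {ι : Type*} [Fintype ι] [DecidableEq ι] {q : LinearMap.BilinForm ℝ V}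
  {b : Module.Basis ι ℝ V}

theorem repr_apply (hb : IsOrthonormalFor q b) (X : V) (i : ι) : b.repr X i = q X (b i) := by
  have h : ∀ j k, q (b j) (b k) = if j = k then 1 else 0 := hb
  conv_rhs => rw [← b.sum_repr X]
  simp only [map_sum, LinearMap.sum_apply, map_smul, LinearMap.smul_apply, h]
  simp

theorem sum_smul (hb : IsOrthonormalFor q b) (X : V) : ∑ i, q X (b i) • b i = X := by
  simp_rw [← hb.repr_apply]
  exact b.sum_repr X

theorem sum_mul (hb : IsOrthonormalFor q b) (X Y : V) : q X Y = ∑ i, q X (b i) * q Y (b i) := by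
  conv_lhs => rw [← hb.sum_smul Y]
  simp [map_sum, mul_comm]

theorem trace_eq (hb : IsOrthonormalFor q b) (f : V →ₗ[ℝ] V) :
    LinearMap.trace ℝ V f = ∑ i, q (f (b i)) (b i) := by
  rw [LinearMap.trace_eq_matrix_trace ℝ b, Matrix.trace]
  refine Finset.sum_congr rfl fun i _ => ?_
  rw [Matrix.diag_apply, LinearMap.toMatrix_apply, hb.repr_apply]

end IsOrthonormalFor

/-- Relabels the cubic sums over structure constants that arise from the Koszul formula. -/
theorem sum_cycle {ι : Type*} [Fintype ι] (F : ι → ι → ι → ℝ) :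
    ∑ i, ∑ j, ∑ k, F j k i = ∑ i, ∑ j, ∑ k, F i j k := by
  rw [Finset.sum_comm]
  exact Finset.sum_congr rfl fun i _ => Finset.sum_comm

/-- A positive definite form and a symmetric form on a nonzero finite-dimensional space have a
common eigenvector. -/
theorem exists_eigenvector [FiniteDimensional ℝ V] [Nontrivial V] (q h : LinearMap.BilinForm ℝ V)
    (hq : ∀ X Y, q X Y = q Y X) (hpos : ∀ X, X ≠ 0 → 0 < q X X) (hh : ∀ X Y, h X Y = h Y X) :
    ∃ c : ℝ, ∃ X, X ≠ 0 ∧ ∀ Y, h X Y = c * q X Y := by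
  have hnn : ∀ X, 0 ≤ q X X := fun X => by
    rcases eq_or_ne X 0 with rfl | hX
    · simp
    · exact (hpos X hX).le
  let core : InnerProductSpace.Core ℝ V :=
    { inner := fun X Y => q X Y
      conj_inner_symm := fun X Y => hq Y X
      re_inner_nonneg := fun X => hnn X
      add_left := fun X Y Z => by simp
      smul_left := fun X Y c => by simp
      definite := fun X hX => by
        by_contra hne
        exact (hpos X hne).ne' hX }
  let _ : NormedAddCommGroup V := core.toNormedAddCommGroup
  let _ : InnerProductSpace ℝ V := InnerProductSpace.ofCore core.toCore
  have hnd : q.Nondegenerate := by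
    refine ⟨fun X hX => ?_, fun X hX => ?_⟩ <;> by_contra hne <;> exact (hpos X hne).ne' (hX X)
  let A : V →ₗ[ℝ] V := (LinearMap.BilinForm.toDual q hnd).symm.toLinearMap ∘ₗ h
  have hA : ∀ X Y, q (A X) Y = h X Y := fun X Y => by
    rw [← LinearMap.BilinForm.toDual_def hnd]
    simp [A]
  have hsymm : A.IsSymmetric := fun X Y => by
    change q (A X) Y = q X (A Y)
    rw [hA, hq X, hA, hh]
  obtain ⟨X, hX⟩ := hsymm.hasEigenvalue_iSup_of_finiteDimensional.exists_hasEigenvector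
  have hAX := hX.apply_eq_smul
  -- The eigenvalue is the supremum of the Rayleigh quotient, but only its existence matters.
  generalize (⨆ x : { x : V // x ≠ 0 }, RCLike.re (inner ℝ (A x) (x : V)) / ‖(x : V)‖ ^ 2 : ℝ) = c
    at hAX
  refine ⟨c, X, hX.2, fun Y => ?_⟩
  rw [← hA, hAX]
  simp

/-- Two invariant symmetric forms, one of them positive definite, on an irreducible
representation are proportional. -/
theorem exists_form_eq_mul [FiniteDimensional ℝ V] [Nontrivial V] (q h : LinearMap.BilinForm ℝ V)
    (hq : ∀ X Y, q X Y = q Y X) (hpos : ∀ X, X ≠ 0 → 0 < q X X) (hh : ∀ X Y, h X Y = h Y X)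
    (F : Set (V →ₗ[ℝ] V)) (hFq : ∀ f ∈ F, ∀ X Y, q (f X) Y = -q X (f Y))
    (hFh : ∀ f ∈ F, ∀ X Y, h (f X) Y = -h X (f Y))
    (irr : ∀ W : Submodule ℝ V, (∀ f ∈ F, ∀ X ∈ W, f X ∈ W) → W ≠ ⊥ → W = ⊤) :
    ∃ c : ℝ, ∀ X Y, h X Y = c * q X Y := by
  obtain ⟨c, X, hX, hc⟩ := exists_eigenvector q h hq hpos hh
  -- Schur's lemma: this eigenspace is stable under `F` because both forms are invariant, and it
  -- contains `X`.
  let W : Submodule ℝ V := LinearMap.ker (h - c • q)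
  have hW : ∀ X, X ∈ W ↔ ∀ Y, h X Y = c * q X Y := fun X => by
    simp only [W, LinearMap.mem_ker, LinearMap.ext_iff, LinearMap.sub_apply, LinearMap.smul_apply,
      smul_eq_mul, sub_eq_zero]
  have htop : W = ⊤ := by
    refine irr W (fun f hf X hX => (hW _).2 fun Y => ?_) ?_
    · rw [hFh f hf, hFq f hf, (hW X).1 hX]
      ring
    · exact fun h0 => hX ((Submodule.eq_bot_iff W).1 h0 X ((hW X).2 hc))
  exact ⟨c, fun X => (hW X).1 (htop ▸ Submodule.mem_top)⟩

/-- A positive definite form has an orthonormal basis. -/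
theorem exists_isOrthonormalFor [FiniteDimensional ℝ V] (q : LinearMap.BilinForm ℝ V)
    (hq : ∀ X Y, q X Y = q Y X) (hpos : ∀ X, X ≠ 0 → 0 < q X X) :
    ∃ b : Module.Basis (Fin (Module.finrank ℝ V)) ℝ V, IsOrthonormalFor q b := by
  obtain ⟨v, hv⟩ := LinearMap.BilinForm.exists_orthogonal_basis (B := q) ⟨hq⟩
  have hv0 : ∀ i, 0 < q (v i) (v i) := fun i => hpos _ (v.ne_zero i)
  refine ⟨v.isUnitSMul (w := fun i => (Real.sqrt (q (v i) (v i)))⁻¹)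
    fun i => (inv_ne_zero (Real.sqrt_pos.2 (hv0 i)).ne').isUnit, fun i j => ?_⟩
  simp only [Module.Basis.isUnitSMul_apply, map_smul, LinearMap.smul_apply, smul_eq_mul]
  split_ifs with hij
  · subst hij
    have := Real.mul_self_sqrt (hv0 i).le
    have h0 := (Real.sqrt_pos.2 (hv0 i)).ne'
    field_simp
    linarith
  · have h0 : q (v i) (v j) = 0 := hv hij
    rw [h0]
    simp

end Forms

/-! ### Traces and the scalar curvature in an orthonormal basis -/

namespace InvMetric

variable {L : Type*} [LieRing L] [LieAlgebra ℝ L] (g : InvMetric L)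
  {ι : Type*} [Fintype ι] [DecidableEq ι] {b : Module.Basis ι ℝ L}

theorem tr_eq_sum [FiniteDimensional ℝ L] (hb : IsOrthonormalFor g.form b)
    (h : LinearMap.BilinForm ℝ L) :
    g.tr h = ∑ i, h (b i) (b i) := by
  rw [tr, hb.trace_eq]
  exact Finset.sum_congr rfl fun i _ => g.form_sharp _ _

theorem killingForm_eq_sum (hb : IsOrthonormalFor g.form b) (i : ι) :
    killingForm ℝ L (b i) (b i) =
      ∑ j, ∑ k, g.form ⁅b i, b j⁆ (b k) * g.form ⁅b i, b k⁆ (b j) := by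
  rw [killingForm_apply_apply, hb.trace_eq]
  refine Finset.sum_congr rfl fun j _ => ?_
  simp only [LinearMap.comp_apply, LieAlgebra.ad_apply]
  conv_lhs => rw [← hb.sum_smul ⁅b i, b j⁆]
  simp [lie_sum, map_sum, LinearMap.sum_apply]

/-- The scalar curvature of a left-invariant metric on a unimodular Lie group. -/
theorem scal_eq [FiniteDimensional ℝ L] (hb : IsOrthonormalFor g.form b)
    (huni : ∀ Z : L, ∑ j, g.form ⁅Z, b j⁆ (b j) = 0) :
    g.scal = -(1 / 4) * (∑ i, ∑ j, ∑ k, g.form ⁅b i, b j⁆ (b k) ^ 2)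
      - (1 / 2) * ∑ i, killingForm ℝ L (b i) (b i) := by
  set c : ι → ι → ι → ℝ := fun i j k => g.form ⁅b i, b j⁆ (b k) with hc
  have hskew : ∀ i j k, c i j k = -c j i k := fun i j k => by
    simp only [hc]
    rw [← lie_skew, map_neg, LinearMap.neg_apply]
  have hΓ : ∀ i j k, g.form (g.nabla (b i) (b j)) (b k) =
      1 / 2 * (c i j k - c j k i + c k i j) := fun i j k => g.form_nabla _ _ _
  -- Pairing this vector with `Z` gives the trace of `ad Z`, which is zero by unimodularity; it
  -- removes the only curvature term that is not a sum over single products of structure constants.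
  have hH : ∑ j, g.nabla (b j) (b j) = 0 := by
    refine g.eq_zero_of_form fun Z => ?_
    rw [map_sum, LinearMap.sum_apply, ← huni Z]
    refine Finset.sum_congr rfl fun j _ => ?_
    rw [form_nabla, ← lie_skew (b j) Z, lie_self]
    simp only [map_neg, map_zero, LinearMap.neg_apply, LinearMap.zero_apply]
    ring
  have hHsum : ∑ j, ∑ i, g.form (g.nabla (b j) (b j)) (g.nabla (b i) (b i)) = 0 := by
    simp_rw [← map_sum, hH]
    simp
  have hterm : ∀ i j, g.form (g.curvEnd (b j) (b j) (b i)) (b i) =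
      -g.form (g.nabla (b j) (b j)) (g.nabla (b i) (b i)) +
        ∑ k, (1 / 2 * (c i j k - c j k i + c k i j) * (1 / 2 * (c j i k - c i k j + c k j i)) -
          c i j k * (1 / 2 * (c k j i - c j i k + c i k j))) := fun i j => by
    have h1 := g.nabla_metric (b i) (g.nabla (b j) (b j)) (b i)
    have h2 := g.nabla_metric (b j) (g.nabla (b i) (b j)) (b i)
    have h3 : g.form (g.nabla (b i) (b j)) (g.nabla (b j) (b i)) =
        ∑ k, 1 / 2 * (c i j k - c j k i + c k i j) * (1 / 2 * (c j i k - c i k j + c k j i)) := by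
      rw [hb.sum_mul]
      exact Finset.sum_congr rfl fun k _ => by rw [hΓ, hΓ]
    have h4 : g.form (g.nabla ⁅b i, b j⁆ (b j)) (b i) =
        ∑ k, c i j k * (1 / 2 * (c k j i - c j i k + c i k j)) := by
      conv_lhs => rw [← hb.sum_smul ⁅b i, b j⁆]
      simp only [map_sum, LinearMap.sum_apply, map_smul, LinearMap.smul_apply, smul_eq_mul]
      exact Finset.sum_congr rfl fun k _ => by rw [hΓ]
    have h5 : g.form (g.curvEnd (b j) (b j) (b i)) (b i) =
        g.form (g.nabla (b i) (g.nabla (b j) (b j))) (b i) -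
          g.form (g.nabla (b j) (g.nabla (b i) (b j))) (b i) -
          g.form (g.nabla ⁅b i, b j⁆ (b j)) (b i) := by
      simp [curvEnd]
    rw [Finset.sum_sub_distrib, ← h3, ← h4, h5]
    linarith
  have hscal : g.scal = ∑ j, ∑ i, g.form (g.curvEnd (b j) (b j) (b i)) (b i) := by
    rw [scal, tr_eq_sum g hb]
    refine Finset.sum_congr rfl fun j _ => ?_
    rw [← hb.trace_eq]
    rfl
  have hpt : ∀ i j k, (1 / 2 * (c i j k - c j k i + c k i j) *
      (1 / 2 * (c j i k - c i k j + c k j i)) - c i j k * (1 / 2 * (c k j i - c j i k + c i k j))) =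
      1 / 4 * c k i j ^ 2 + 1 / 4 * c j k i ^ 2 - 3 / 4 * c i j k ^ 2 - 1 / 2 * (c k i j * c j k i)
        + 1 / 2 * (c i j k * c j k i) + 1 / 2 * (c i j k * c k i j) := fun i j k => by
    rw [hskew j i k, hskew i k j, hskew k j i]
    ring
  rw [hscal, Finset.sum_comm]
  change _ = -(1 / 4) * (∑ i, ∑ j, ∑ k, c i j k ^ 2) - _
  simp only [hterm, hpt, Finset.sum_add_distrib, Finset.sum_neg_distrib, Finset.sum_sub_distrib,
    ← Finset.mul_sum]
  rw [Finset.sum_comm, hHsum]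
  have hK : ∑ i, killingForm ℝ L (b i) (b i) = -∑ i, ∑ j, ∑ k, c i j k * c k i j := by
    simp_rw [killingForm_eq_sum g hb, ← Finset.sum_neg_distrib]
    refine Finset.sum_congr rfl fun i _ => Finset.sum_congr rfl fun j _ =>
      Finset.sum_congr rfl fun k _ => ?_
    change c i j k * c i k j = _
    rw [hskew i k j]
    ring
  -- Up to cyclic relabelling only two sums remain, that of the squares and that of `c i j k * c k i
  -- j`; by `hK` the latter is minus the trace of the Killing form.
  have e1 := sum_cycle fun i j k => c i j k ^ 2
  have e2 := sum_cycle fun i j k => c k i j ^ 2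
  have e3 := sum_cycle fun i j k => c i j k * c k i j
  have e4 := sum_cycle fun i j k => c k i j * c j k i
  have e5 : ∑ i, ∑ j, ∑ k, c j k i * c i j k = ∑ i, ∑ j, ∑ k, c i j k * c j k i := by
    simp_rw [mul_comm]
  rw [hK]
  linarith

end InvMetric

/-! ### Lie algebras with an invariant positive definite form -/

section Compact

variable {R : Type*} [LieRing R] [LieAlgebra ℝ R]

/-- The bilinear form `q` on the Lie algebra `R` is symmetric, positive definite and invariant. -/
structure IsInvariantInner (q : LinearMap.BilinForm ℝ R) : Prop where
  symm : ∀ X Y, q X Y = q Y X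
  pos : ∀ X, X ≠ 0 → 0 < q X X
  inv : ∀ X Y Z : R, q ⁅X, Y⁆ Z = -q Y ⁅X, Z⁆

/-- A subspace on which a symmetric form is positive definite is complemented by its orthogonal
complement. -/
theorem exists_add_orthogonal {V : Type*} [AddCommGroup V] [Module ℝ V] [FiniteDimensional ℝ V]
    {q : LinearMap.BilinForm ℝ V} (hq : ∀ X Y, q X Y = q Y X) (W : Submodule ℝ V)
    (hpos : ∀ X ∈ W, X ≠ 0 → q X X ≠ 0) (X : V) :
    ∃ Y ∈ W, ∃ Z, X = Y + Z ∧ ∀ U ∈ W, q U Z = 0 := by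
  have hnd : (q.restrict W).Nondegenerate := by
    refine ⟨fun U hU => ?_, fun U hU => ?_⟩ <;> by_contra hne <;>
      exact hpos U U.2 (by simpa using hne) (hU U)
  have hc := LinearMap.BilinForm.isCompl_orthogonal_of_restrict_nondegenerate
    (B := q) (W := W) (fun U U' h => by rw [hq]; exact h) hnd
  obtain ⟨Y, hY, Z, hZ, h⟩ := Submodule.mem_sup.1 (hc.sup_eq_top ▸ Submodule.mem_top (x := X))
  exact ⟨Y, hY, Z, h.symm, fun U hU => hZ U hU⟩

theorem eq_bot_or_eq_of_le_of_isSimple {A : LieIdeal ℝ R} (hA : LieAlgebra.IsSimple ℝ A)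
    {I : LieIdeal ℝ R} (hI : I ≤ A) : I = ⊥ ∨ I = A := by
  rcases hA.eq_bot_or_eq_top (LieIdeal.comap A.incl I) with h | h
  · left
    refine (LieSubmodule.eq_bot_iff I).2 fun X hX => ?_
    have hm : (⟨X, hI hX⟩ : A) ∈ LieIdeal.comap A.incl I := by
      rw [LieIdeal.mem_comap]
      exact hX
    rw [h, LieSubmodule.mem_bot] at hm
    exact congrArg Subtype.val hm
  · right
    refine le_antisymm hI fun X hX => ?_
    have hm : (⟨X, hX⟩ : A) ∈ LieIdeal.comap A.incl I := h ▸ LieSubmodule.mem_top _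
    rw [LieIdeal.mem_comap] at hm
    exact hm

theorem exists_lie_ne_zero_of_isSimple {A : LieIdeal ℝ R} (hA : LieAlgebra.IsSimple ℝ A) :
    ∃ X ∈ A, ∃ Y ∈ A, ⁅X, Y⁆ ≠ 0 := by
  by_contra! h
  exact hA.non_abelian ⟨fun X Y => Subtype.ext (h X X.2 Y Y.2)⟩

/-- A simple ideal is orthogonal to every ideal commuting with it, with respect to an invariant
form. -/
theorem form_eq_zero_of_isSimple {A C : LieIdeal ℝ R} (hA : LieAlgebra.IsSimple ℝ A)
    (hAC : ∀ X ∈ A, ∀ Y ∈ C, ⁅X, Y⁆ = 0) (h : LinearMap.BilinForm ℝ R)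
    (hinv : ∀ X Y Z : R, h ⁅X, Y⁆ Z = -h Y ⁅X, Z⁆) {X Y : R} (hX : X ∈ A) (hY : Y ∈ C) :
    h X Y = 0 := by
  -- The part of `A` orthogonal to `C` is an ideal, hence `⊥` or `A`; it contains all brackets of
  -- `A`, which do not all vanish.
  let I : LieIdeal ℝ R :=
    { carrier := {X | X ∈ A ∧ ∀ Y ∈ C, h X Y = 0}
      add_mem' := fun {U V} hU hV => ⟨add_mem hU.1 hV.1, fun Y hY => by
        rw [map_add, LinearMap.add_apply, hU.2 Y hY, hV.2 Y hY, add_zero]⟩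
      zero_mem' := ⟨zero_mem _, fun Y _ => by simp⟩
      smul_mem' := fun c U hU => ⟨A.smul_mem c hU.1, fun Y hY => by
        rw [map_smul, LinearMap.smul_apply, hU.2 Y hY, smul_zero]⟩
      lie_mem := fun {Z U} hU => ⟨lie_mem_right ℝ R A Z U hU.1, fun Y hY => by
        rw [hinv, hU.2 _ (lie_mem_right ℝ R C Z Y hY), neg_zero]⟩ }
  have hIA : I ≤ A := fun U hU => hU.1
  rcases eq_bot_or_eq_of_le_of_isSimple hA hIA with h0 | h0
  · exfalso
    obtain ⟨U, hU, V, hV, hUV⟩ := exists_lie_ne_zero_of_isSimple hA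
    have hm : ⁅U, V⁆ ∈ I := ⟨lie_mem_right ℝ R A U V hV, fun Y hY => by
      rw [hinv, hAC U hU Y hY, map_zero, neg_zero]⟩
    rw [h0, LieSubmodule.mem_bot] at hm
    exact hUV hm
  · have hm : X ∈ I := h0 ▸ hX
    exact hm.2 Y hY

/-! ### Ideals of a Lie algebra with an invariant inner product -/

namespace IsInvariantInner

variable {q : LinearMap.BilinForm ℝ R}

theorem eq_zero (hq : IsInvariantInner q) {X : R} (h : q X X = 0) : X = 0 := by
  by_contra hX
  exact (hq.pos X hX).ne' h

variable [FiniteDimensional ℝ R]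

/-- Every element is the sum of an element of the ideal `A` and an element commuting with `A`. -/
theorem exists_add_commuting (hq : IsInvariantInner q) (A : LieIdeal ℝ R) (X : R) :
    ∃ Y ∈ A, ∃ Z, X = Y + Z ∧ (∀ U ∈ A, q U Z = 0) ∧ ∀ U ∈ A, ⁅Z, U⁆ = 0 := by
  obtain ⟨Y, hY, Z, h, hZ⟩ := exists_add_orthogonal hq.symm A.toSubmodule
    (fun X _ hX => (hq.pos X hX).ne') X
  refine ⟨Y, hY, Z, h, hZ, fun U hU => hq.eq_zero ?_⟩
  -- The square length of `⁅U, Z⁆` is `-q Z ⁅U, ⁅U, Z⁆⁆`, and `⁅U, ⁅U, Z⁆⁆` lies in `A`, to which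
  -- `Z` is orthogonal.
  rw [← lie_skew Z U, map_neg, map_neg, LinearMap.neg_apply, neg_neg, hq.inv, hq.symm,
    hZ _ (lie_mem_left ℝ R A _ _ hU), neg_zero]

/-- The orthogonal complement of an ideal commutes with it, so only brackets within `A` could
obstruct centrality. -/
theorem le_center_of_isLieAbelian (hq : IsInvariantInner q) (A : LieIdeal ℝ R)
    (hA : IsLieAbelian A) : A ≤ LieAlgebra.center ℝ R := by
  intro U hU
  rw [LieModule.mem_maxTrivSubmodule]
  intro X
  obtain ⟨Y, hY, Z, rfl, -, hZ⟩ := hq.exists_add_commuting A X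
  rw [add_lie, hZ U hU, add_zero]
  exact congrArg Subtype.val (hA.trivial ⟨Y, hY⟩ ⟨U, hU⟩)

/-- Since the orthogonal complement of `A` commutes with `A`, ideals of `A` are ideals of the whole
algebra, and minimality applies to them. -/
theorem isSimple_of_isAtom (hq : IsInvariantInner q) {A : LieIdeal ℝ R} (hA : IsAtom A)
    (hab : ¬ IsLieAbelian A) : LieAlgebra.IsSimple ℝ A := by
  refine ⟨fun I => ?_, hab⟩
  let J : LieIdeal ℝ R :=
    { I.toSubmodule.map A.toSubmodule.subtype with
      lie_mem := by
        rintro X _ ⟨U, hU, rfl⟩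
        obtain ⟨Y, hY, Z, rfl, -, hZ⟩ := hq.exists_add_commuting A X
        refine ⟨⁅(⟨Y, hY⟩ : A), U⁆, lie_mem_right ℝ A I _ _ hU, ?_⟩
        have := hZ U U.2
        simp only [Submodule.subtype_apply, add_lie]
        erw [this, add_zero]
        rfl }
  have hJA : J ≤ A := by
    rintro _ ⟨U, _, rfl⟩
    exact U.2
  rcases hA.le_iff.1 hJA with h | h
  · left
    refine (LieSubmodule.eq_bot_iff I).2 fun U hU => Subtype.ext ?_
    have hm : (U : R) ∈ J := ⟨U, hU, rfl⟩
    rw [h, LieSubmodule.mem_bot] at hm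
    exact hm
  · right
    refine eq_top_iff.2 fun U _ => ?_
    have hm : (U : R) ∈ J := by
      rw [h]
      exact U.2
    obtain ⟨V, hV, hVU⟩ := hm
    rwa [← show V = U from Subtype.ext hVU]

/-- An ideal that contains the centre and all simple ideals is the whole algebra. -/
theorem eq_top_of_forall_le (hq : IsInvariantInner q) (S : LieIdeal ℝ R)
    (hc : LieAlgebra.center ℝ R ≤ S) (hs : ∀ A : LieIdeal ℝ R, LieAlgebra.IsSimple ℝ A → A ≤ S) :
    S = ⊤ := by
  -- If `S` were proper, its orthogonal ideal would contain a minimal ideal. That ideal is central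
  -- or simple, hence also inside `S`, hence zero by definiteness.
  let J : LieIdeal ℝ R :=
    { toSubmodule := q.orthogonal S.toSubmodule
      lie_mem := by
        intro X U hU Y hY
        have h := hU ⁅X, Y⁆ (lie_mem_right ℝ R S X Y hY)
        have h' := hq.inv X Y U
        have h'' : q ⁅X, Y⁆ U = 0 := h
        change q Y ⁅X, U⁆ = 0
        linarith }
  have hJ : ∀ U, U ∈ J → U ∈ S → U = 0 := fun U hU hS => hq.eq_zero (hU U hS)
  by_contra hS
  have hJne : J ≠ ⊥ := fun h0 => hS <| eq_top_iff.2 fun X _ => by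
    obtain ⟨Y, hY, Z, rfl, hZ, -⟩ := hq.exists_add_commuting S X
    have hm : Z ∈ J := fun U hU => hZ U hU
    rw [h0, LieSubmodule.mem_bot] at hm
    rw [hm, add_zero]
    exact hY
  obtain ⟨A, hA, hAJ⟩ := (eq_bot_or_exists_atom_le J).resolve_left hJne
  have hAS : A ≤ S := by
    by_cases hab : IsLieAbelian A
    · exact (hq.le_center_of_isLieAbelian A hab).trans hc
    · exact hs A (hq.isSimple_of_isAtom hA hab)
  exact hA.1 ((LieSubmodule.eq_bot_iff A).2 fun U hU => hJ U (hAJ hU) (hAS hU))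

end IsInvariantInner

end Compact

/-! ### Cartan decompositions -/

section Cartan

variable {L : Type*} [LieRing L] [LieAlgebra ℝ L] {𝔨 : LieSubalgebra ℝ L}

theorem killingForm_symm (X Y : L) : killingForm ℝ L X Y = killingForm ℝ L Y X :=
  LieModule.traceForm_comm ℝ L L X Y

theorem killingForm_inv (X Y Z : L) : killingForm ℝ L ⁅X, Y⁆ Z = -killingForm ℝ L Y ⁅X, Z⁆ :=
  LieModule.traceForm_apply_lie_apply' ℝ L L X Y Z

theorem killingForm_eq_zero_of_mem {X Z : L} (hZ : Z ∈ 𝔨) (hX : X ∈ complP 𝔨) :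
    killingForm ℝ L Z X = 0 :=
  hX Z hZ

theorem killingForm_eq_zero_of_mem' {X Z : L} (hZ : Z ∈ 𝔨) (hX : X ∈ complP 𝔨) :
    killingForm ℝ L X Z = 0 := by
  rw [killingForm_symm, killingForm_eq_zero_of_mem hZ hX]

theorem lie_mem_complP {X Z : L} (hZ : Z ∈ 𝔨) (hX : X ∈ complP 𝔨) : ⁅Z, X⁆ ∈ complP 𝔨 := by
  intro Y hY
  have h := killingForm_inv Z Y X
  have h' := killingForm_eq_zero_of_mem (𝔨.lie_mem hZ hY) hX
  change killingForm ℝ L Y ⁅Z, X⁆ = 0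
  linarith

variable (𝔨) in
/-- The restriction of minus the Killing form of `L` to `𝔨`. -/
def compactForm : LinearMap.BilinForm ℝ 𝔨 :=
  -(killingForm ℝ L).restrict 𝔨.toSubmodule

theorem compactForm_apply (X Y : 𝔨) : compactForm 𝔨 X Y = -killingForm ℝ L (X : L) (Y : L) :=
  rfl

/-! ### The `𝔨`-module `𝔭` -/

namespace IsCartanDecomposition

theorem isInvariantInner (hC : IsCartanDecomposition 𝔨) : IsInvariantInner (compactForm 𝔨) where
  symm X Y := by rw [compactForm_apply, compactForm_apply, killingForm_symm]
  pos X hX := by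
    rw [compactForm_apply]
    have := hC.neg_on_k X X.2 (by simpa using hX)
    linarith
  inv X Y Z := by
    rw [compactForm_apply, compactForm_apply, LieSubalgebra.coe_bracket, LieSubalgebra.coe_bracket,
      killingForm_inv]

theorem eq_zero_of_mem_k (hC : IsCartanDecomposition 𝔨) {X : L} (hX : X ∈ 𝔨)
    (h : killingForm ℝ L X X = 0) : X = 0 := by
  by_contra hne
  exact (hC.neg_on_k X hX hne).ne h

theorem eq_zero_of_mem_p (hC : IsCartanDecomposition 𝔨) {X : L} (hX : X ∈ complP 𝔨)
    (h : killingForm ℝ L X X = 0) : X = 0 := by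
  by_contra hne
  exact (hC.pos_on_p X hX hne).ne' h

theorem eq_zero_of_mem (hC : IsCartanDecomposition 𝔨) {X : L} (hX : X ∈ 𝔨)
    (hX' : X ∈ complP 𝔨) : X = 0 :=
  hC.eq_zero_of_mem_k hX (killingForm_eq_zero_of_mem hX hX')

variable [FiniteDimensional ℝ L]

theorem exists_add (hC : IsCartanDecomposition 𝔨) (X : L) :
    ∃ Z ∈ 𝔨, ∃ Y ∈ complP 𝔨, X = Z + Y := by
  obtain ⟨Z, hZ, Y, h, hY⟩ := exists_add_orthogonal killingForm_symm 𝔨.toSubmodule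
    (fun Z hZ h0 => (hC.neg_on_k Z hZ h0).ne) X
  exact ⟨Z, hZ, Y, hY, h⟩

/-- If `L` is simple, then the `𝔨`-module `𝔭` is irreducible. -/
theorem eq_complP_of_invariant (hC : IsCartanDecomposition 𝔨) (hL : LieAlgebra.IsSimple ℝ L)
    (V : Submodule ℝ L) (hV : V ≤ complP 𝔨) (hinv : ∀ Z ∈ 𝔨, ∀ X ∈ V, ⁅Z, X⁆ ∈ V) (hne : V ≠ ⊥) :
    V = complP 𝔨 := by
  -- Invariance turns the square of `⁅Y, X⁆ ∈ 𝔨` into a pairing of `Y` with `⁅⁅Y, X⁆, X⁆`, which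
  -- lies in `V` by `𝔨`-stability and is thus orthogonal to `Y`.
  have hcomm : ∀ X ∈ V, ∀ Y ∈ complP 𝔨, (∀ U ∈ V, killingForm ℝ L U Y = 0) → ⁅Y, X⁆ = 0 := by
    intro X hX Y hY hYV
    have hk : ⁅Y, X⁆ ∈ 𝔨 := hC.lie_p_p Y hY X (hV hX)
    refine hC.eq_zero_of_mem_k hk ?_
    have h1 : ⁅⁅Y, X⁆, X⁆ ∈ V := hinv _ hk X hX
    rw [← lie_skew Y X, map_neg, map_neg, LinearMap.neg_apply, neg_neg, killingForm_inv,
      killingForm_symm, ← lie_skew, ← lie_skew X Y]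
    rw [neg_lie, map_neg, map_neg, LinearMap.neg_apply, LinearMap.neg_apply, hYV _ h1]
    simp
  have hdec : ∀ X : L, ∃ Z ∈ 𝔨, ∃ Y ∈ V, ∃ Y' ∈ complP 𝔨,
      X = Z + Y + Y' ∧ ∀ U ∈ V, ⁅Y', U⁆ = 0 := fun X => by
    obtain ⟨Z, hZ, W, hW, rfl⟩ := hC.exists_add X
    obtain ⟨Y, hY, Y', rfl, hY'⟩ := exists_add_orthogonal killingForm_symm V
      (fun Z hZ h0 => (hC.pos_on_p Z (hV hZ) h0).ne') W
    have hmem : Y' ∈ complP 𝔨 := by simpa using sub_mem hW (hV hY)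
    exact ⟨Z, hZ, Y, hY, Y', hmem, by abel, fun U hU => hcomm U hU Y' hmem hY'⟩
  let D : Submodule ℝ L := Submodule.span ℝ {W | ∃ X ∈ V, ∃ Y ∈ V, W = ⁅X, Y⁆}
  have hD : D ≤ 𝔨.toSubmodule := Submodule.span_le.2 fun W ⟨X, hX, Y, hY, h⟩ =>
    h ▸ hC.lie_p_p X (hV hX) Y (hV hY)
  have hbr : ∀ X ∈ V, ∀ Y ∈ V, ⁅X, Y⁆ ∈ D := fun X hX Y hY =>
    Submodule.subset_span ⟨X, hX, Y, hY, rfl⟩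
  -- `V + [V, V]` is stable under `𝔨` and `V`, while the complement of `V` in `𝔭` kills it; so it is
  -- an ideal of the simple algebra `L`, and its `𝔭`-part is `V`.
  let I : LieIdeal ℝ L :=
    { toSubmodule := V ⊔ D
      lie_mem := by
        intro X W hW
        obtain ⟨Z, hZ, Y, hY, Y', hY', rfl, h0⟩ := hdec X
        change _ ∈ V ⊔ D
        obtain ⟨U, hU, E, hE, rfl⟩ := Submodule.mem_sup.1 hW
        rw [lie_add]
        refine add_mem ?_ ?_
        · rw [add_lie, add_lie, h0 U hU, add_zero]
          exact add_mem (Submodule.mem_sup_left (hinv Z hZ U hU))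
            (Submodule.mem_sup_right (hbr Y hY U hU))
        · induction hE using Submodule.span_induction with
          | mem E hE =>
            obtain ⟨A, hA, C, hC', rfl⟩ := hE
            rw [add_lie, add_lie]
            refine add_mem (add_mem (Submodule.mem_sup_right ?_) (Submodule.mem_sup_left ?_)) ?_
            · rw [leibniz_lie]
              exact add_mem (hbr _ (hinv Z hZ A hA) _ hC') (hbr _ hA _ (hinv Z hZ C hC'))
            · rw [← lie_skew]
              exact neg_mem (hinv _ (hD (hbr A hA C hC')) Y hY)
            · rw [leibniz_lie, h0 A hA, h0 C hC', zero_lie, lie_zero, add_zero]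
              exact zero_mem _
          | zero => simp
          | add E F _ _ hE hF =>
            rw [lie_add]
            exact add_mem (hE (Submodule.add_mem_sup hU ‹_›)) (hF (Submodule.add_mem_sup hU ‹_›))
          | smul c E _ hE =>
            rw [lie_smul]
            exact Submodule.smul_mem _ _ (hE (Submodule.add_mem_sup hU ‹_›)) }
  rcases hL.eq_bot_or_eq_top I with h | h
  · exfalso
    refine hne ((Submodule.eq_bot_iff V).2 fun X hX => ?_)
    have hm : X ∈ I := Submodule.mem_sup_left hX
    rwa [h, LieSubmodule.mem_bot] at hm
  · refine le_antisymm hV fun X hX => ?_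
    have hm : X ∈ I := h ▸ LieSubmodule.mem_top X
    obtain ⟨U, hU, E, hE, rfl⟩ := Submodule.mem_sup.1 hm
    have hE0 : E = 0 := hC.eq_zero_of_mem (hD hE) (by simpa using sub_mem hX (hV hU))
    rw [hE0, add_zero]
    exact hU

/-- If `L` is simple, then the invariant symmetric forms on `𝔭` are the multiples of the Killing
form. -/
theorem exists_form_eq_mul_of_mem_p (hC : IsCartanDecomposition 𝔨)
    (hL : LieAlgebra.IsSimple ℝ L) (h : LinearMap.BilinForm ℝ L)
    (hsymm : ∀ X ∈ complP 𝔨, ∀ Y ∈ complP 𝔨, h X Y = h Y X)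
    (hinv : ∀ Z ∈ 𝔨, ∀ X ∈ complP 𝔨, ∀ Y ∈ complP 𝔨, h ⁅Z, X⁆ Y = -h X ⁅Z, Y⁆) :
    ∃ c : ℝ, ∀ X ∈ complP 𝔨, ∀ Y ∈ complP 𝔨, h X Y = c * killingForm ℝ L X Y := by
  rcases subsingleton_or_nontrivial (complP 𝔨) with hs | hn
  · refine ⟨0, fun X hX Y hY => ?_⟩
    have : X = 0 := congrArg Subtype.val (Subsingleton.elim (⟨X, hX⟩ : complP 𝔨) 0)
    simp [this]
  let act (Z : 𝔨) : complP 𝔨 →ₗ[ℝ] complP 𝔨 :=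
    (LieAlgebra.ad ℝ L (Z : L)).restrict fun X hX => lie_mem_complP Z.2 hX
  obtain ⟨c, hc⟩ := exists_form_eq_mul ((killingForm ℝ L).restrict (complP 𝔨))
    (h.restrict (complP 𝔨)) (fun X Y => killingForm_symm _ _)
    (fun X hX => hC.pos_on_p X X.2 (by simpa using hX)) (fun X Y => hsymm X X.2 Y Y.2)
    (Set.range act) (by rintro _ ⟨Z, rfl⟩ X Y; exact killingForm_inv _ _ _)
    (by rintro _ ⟨Z, rfl⟩ X Y; exact hinv Z Z.2 X X.2 Y Y.2) (fun W hW hne => by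
      have hmap := hC.eq_complP_of_invariant hL (W.map (complP 𝔨).subtype)
        (by rintro _ ⟨X, _, rfl⟩; exact X.2)
        (by
          rintro Z hZ _ ⟨X, hX, rfl⟩
          exact ⟨act ⟨Z, hZ⟩ X, hW _ ⟨_, rfl⟩ X hX, rfl⟩)
        (fun h0 => hne ((Submodule.eq_bot_iff W).2 fun X hX => Subtype.ext
          ((Submodule.eq_bot_iff _).1 h0 X ⟨X, hX, rfl⟩)))
      refine eq_top_iff.2 fun X _ => ?_
      obtain ⟨Y, hY, hYX⟩ : (X : L) ∈ W.map (complP 𝔨).subtype := by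
        rw [hmap]
        exact X.2
      rwa [← show Y = X from Subtype.ext hYX])
  exact ⟨c, fun X hX Y hY => hc ⟨X, hX⟩ ⟨Y, hY⟩⟩

/-- If `L` is simple and `𝔭` is not trivial, then `𝔨` acts faithfully on `𝔭`. -/
theorem eq_zero_of_lie_eq_zero (hC : IsCartanDecomposition 𝔨) (hL : LieAlgebra.IsSimple ℝ L)
    (hp : complP 𝔨 ≠ ⊥) {Z : L} (hZ : Z ∈ 𝔨) (h : ∀ X ∈ complP 𝔨, ⁅Z, X⁆ = 0) : Z = 0 := by
  -- The kernel of the action of `𝔨` on `𝔭` is an ideal of `L`; if it were everything, then `𝔭`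
  -- would lie in `𝔨`.
  let I : LieIdeal ℝ L :=
    { carrier := {Z | Z ∈ 𝔨 ∧ ∀ X ∈ complP 𝔨, ⁅Z, X⁆ = 0}
      add_mem' := fun {U V} hU hV => ⟨add_mem hU.1 hV.1, fun Y hY => by
        rw [add_lie, hU.2 Y hY, hV.2 Y hY, add_zero]⟩
      zero_mem' := ⟨zero_mem _, fun Y _ => by simp⟩
      smul_mem' := fun c U hU => ⟨𝔨.smul_mem c hU.1, fun Y hY => by
        rw [smul_lie, hU.2 Y hY, smul_zero]⟩
      lie_mem := by
        rintro X U ⟨hU, hU0⟩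
        obtain ⟨V, hV, Y, hY, rfl⟩ := hC.exists_add X
        have h0 : ⁅Y, U⁆ = 0 := by rw [← lie_skew, hU0 Y hY, neg_zero]
        rw [add_lie, h0, add_zero]
        refine ⟨𝔨.lie_mem hV hU, fun W hW => ?_⟩
        rw [lie_lie, hU0 W hW, hU0 _ (lie_mem_complP hV hW), lie_zero, sub_zero] }
  rcases hL.eq_bot_or_eq_top I with h0 | h0
  · have hm : Z ∈ I := ⟨hZ, h⟩
    rwa [h0, LieSubmodule.mem_bot] at hm
  · exfalso
    refine hp ((Submodule.eq_bot_iff _).2 fun X hX => ?_)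
    have hm : X ∈ I := h0 ▸ LieSubmodule.mem_top X
    exact hC.eq_zero_of_mem hm.1 hX

/-- If `L` is simple and `𝔭` is not trivial, then the centre of `𝔨` is at most one-dimensional. -/
theorem exists_smul_eq_of_mem_center (hC : IsCartanDecomposition 𝔨)
    (hL : LieAlgebra.IsSimple ℝ L) (hp : complP 𝔨 ≠ ⊥) {U V : 𝔨}
    (hU : U ∈ LieAlgebra.center ℝ 𝔨) (hV : V ∈ LieAlgebra.center ℝ 𝔨) (hU0 : U ≠ 0) :
    ∃ c : ℝ, V = c • U := by
  have hcomm : ∀ W ∈ LieAlgebra.center ℝ 𝔨, ∀ Z ∈ 𝔨, ∀ X : L,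
      ⁅Z, ⁅(W : L), X⁆⁆ = ⁅(W : L), ⁅Z, X⁆⁆ := fun W hW Z hZ X => by
    have h1 : ⁅Z, (W : L)⁆ = 0 :=
      congrArg Subtype.val ((LieModule.mem_maxTrivSubmodule ℝ 𝔨 𝔨 W).1 hW ⟨Z, hZ⟩)
    rw [leibniz_lie, h1, zero_lie, zero_add]
  -- For central `U` and `W` this form is symmetric and `𝔨`-invariant, so on `𝔭` it is a multiple of
  -- the Killing form by irreducibility.
  let f (W : 𝔨) : LinearMap.BilinForm ℝ L :=
    (killingForm ℝ L).compl₁₂ (LieAlgebra.ad ℝ L (U : L)) (LieAlgebra.ad ℝ L (W : L))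
  have hf : ∀ W X Y, f W X Y = killingForm ℝ L ⁅(U : L), X⁆ ⁅(W : L), Y⁆ := fun _ _ _ => rfl
  have key : ∀ W ∈ LieAlgebra.center ℝ 𝔨,
      ∃ c : ℝ, ∀ X ∈ complP 𝔨, ∀ Y ∈ complP 𝔨, f W X Y = c * killingForm ℝ L X Y := by
    intro W hW
    refine hC.exists_form_eq_mul_of_mem_p hL (f W) (fun X _ Y _ => ?_) fun Z hZ X _ Y _ => ?_
    · rw [hf, hf, killingForm_inv, hcomm W hW U U.2, ← killingForm_inv, killingForm_symm]
    · rw [hf, hf, ← hcomm U hU Z hZ, killingForm_inv, hcomm W hW Z hZ]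
  obtain ⟨c, hc⟩ := key U hU
  obtain ⟨c', hc'⟩ := key V hV
  have hc0 : c ≠ 0 := by
    rintro rfl
    refine hU0 (Subtype.ext (hC.eq_zero_of_lie_eq_zero hL hp U.2 fun X hX =>
      hC.eq_zero_of_mem_p (lie_mem_complP U.2 hX) ?_))
    rw [← hf, hc X hX X hX, zero_mul]
  refine ⟨c' / c, ?_⟩
  have hV' : ((V - (c' / c) • U : 𝔨) : L) = 0 := by
    refine hC.eq_zero_of_lie_eq_zero hL hp (V - (c' / c) • U).2 fun Y hY => ?_
    set W : L := ⁅((V - (c' / c) • U : 𝔨) : L), Y⁆ with hW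
    have hWp : W ∈ complP 𝔨 := lie_mem_complP (V - (c' / c) • U).2 hY
    -- The quotient `c' / c` makes the forms of `U` and `V` cancel, so `W` is orthogonal to `[U,
    -- 𝔭]`. Then `⁅U, W⁆ = 0`, and `c * B(W, W) = 0` with `c ≠ 0`.
    have h0 : ∀ X ∈ complP 𝔨, killingForm ℝ L ⁅(U : L), X⁆ W = 0 := fun X hX => by
      have e1 := hc X hX Y hY
      have e2 := hc' X hX Y hY
      rw [hf] at e1 e2
      have e3 : W = ⁅(V : L), Y⁆ - (c' / c) • ⁅(U : L), Y⁆ := by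
        rw [hW]
        simp
      rw [e3, map_sub, map_smul, e1, e2, smul_eq_mul]
      field_simp
      ring
    have h1 : ⁅(U : L), W⁆ = 0 := by
      refine hC.eq_zero_of_mem_p (lie_mem_complP U.2 hWp) ?_
      rw [killingForm_inv, killingForm_symm, h0 _ (lie_mem_complP U.2 hWp), neg_zero]
    have h2 := hc W hWp W hWp
    rw [hf, h1, map_zero] at h2
    exact hC.eq_zero_of_mem_p hWp ((mul_eq_zero.1 h2.symm).resolve_left hc0)
  exact sub_eq_zero.1 (Subtype.ext hV')

end IsCartanDecomposition

end Cartan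

/-! ### The ideals of the compact part -/

section Ideals

variable {L : Type*} [LieRing L] [LieAlgebra ℝ L] {𝔨 : LieSubalgebra ℝ L} {m : ℕ}
  {𝔣 : Fin m → LieIdeal ℝ 𝔨}

/-- If `𝔭` is trivial, then `𝔨` is everything, hence simple, and has only one simple ideal. -/
theorem IsCartanDecomposition.complP_ne_bot [FiniteDimensional ℝ L]
    (hC : IsCartanDecomposition 𝔨) (hL : LieAlgebra.IsSimple ℝ L)
    (h𝔣 : IsIdealDecomposition 𝔨 𝔣) {i j : Fin m} (hij : i ≠ j) : complP 𝔨 ≠ ⊥ := by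
  intro hp
  have htop : ∀ X : L, X ∈ 𝔨 := fun X => by
    obtain ⟨Z, hZ, Y, hY, rfl⟩ := hC.exists_add X
    rw [hp, Submodule.mem_bot] at hY
    rwa [hY, add_zero]
  have hid : ∀ I : LieIdeal ℝ 𝔨, I = ⊥ ∨ I = ⊤ := fun I => by
    let J : LieIdeal ℝ L :=
      { toSubmodule := I.toSubmodule.map 𝔨.toSubmodule.subtype
        lie_mem := by
          rintro X _ ⟨U, hU, rfl⟩
          exact ⟨⁅(⟨X, htop X⟩ : 𝔨), U⁆, lie_mem_right ℝ 𝔨 I _ _ hU, rfl⟩ }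
    rcases hL.eq_bot_or_eq_top J with h | h
    · left
      refine (LieSubmodule.eq_bot_iff I).2 fun U hU => Subtype.ext ?_
      have hm : (U : L) ∈ J := ⟨U, hU, rfl⟩
      rwa [h, LieSubmodule.mem_bot] at hm
    · right
      refine eq_top_iff.2 fun U _ => ?_
      have hm : (U : L) ∈ J := h ▸ LieSubmodule.mem_top _
      obtain ⟨V, hV, hVU⟩ := hm
      rwa [← show V = U from Subtype.ext hVU]
  have hcenter : LieAlgebra.center ℝ 𝔨 = ⊥ := by
    refine (hid _).resolve_right fun h => hL.non_abelian ⟨fun X Y => ?_⟩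
    have hm : (⟨Y, htop Y⟩ : 𝔨) ∈ LieAlgebra.center ℝ 𝔨 := h ▸ LieSubmodule.mem_top _
    exact congrArg Subtype.val ((LieModule.mem_maxTrivSubmodule ℝ 𝔨 𝔨 _).1 hm ⟨X, htop X⟩)
  have hall : ∀ i, 𝔣 i = ⊤ := fun i => by
    rcases (h𝔣.mem_range (𝔣 i)).1 ⟨i, rfl⟩ with h | h
    · refine (hid _).resolve_left fun h0 => ?_
      obtain ⟨X, hX, Y, hY, hne⟩ := exists_lie_ne_zero_of_isSimple h
      rw [h0, LieSubmodule.mem_bot] at hX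
      exact hne (by rw [hX, zero_lie])
    · exact absurd hcenter h.2
  exact hij (h𝔣.injective ((hall i).trans (hall j).symm))

/-! ### Commutation, orthogonality and irreducibility of the ideals -/

namespace IsIdealDecomposition

theorem isSimple_or (h𝔣 : IsIdealDecomposition 𝔨 𝔣) (i : Fin m) :
    LieAlgebra.IsSimple ℝ (𝔣 i) ∨
      (𝔣 i = LieAlgebra.center ℝ 𝔨 ∧ LieAlgebra.center ℝ 𝔨 ≠ ⊥) :=
  (h𝔣.mem_range (𝔣 i)).1 ⟨i, rfl⟩

theorem ne_bot (h𝔣 : IsIdealDecomposition 𝔨 𝔣) (i : Fin m) : 𝔣 i ≠ ⊥ := by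
  rcases h𝔣.isSimple_or i with h | h
  · intro h0
    obtain ⟨X, hX, Y, hY, hne⟩ := exists_lie_ne_zero_of_isSimple h
    rw [h0, LieSubmodule.mem_bot] at hX
    exact hne (by rw [hX, zero_lie])
  · rw [h.1]
    exact h.2

theorem nontrivial (h𝔣 : IsIdealDecomposition 𝔨 𝔣) (i : Fin m) : Nontrivial (𝔣 i) :=
  (LieSubmodule.nontrivial_iff_ne_bot ℝ 𝔨 𝔨).2 (h𝔣.ne_bot i)

/-- Otherwise `𝔣 i` is contained in `𝔣 j`: two nested simple ideals coincide, and a simple ideal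
cannot lie in the centre because it is not abelian. -/
theorem disjoint_of_isSimple (h𝔣 : IsIdealDecomposition 𝔨 𝔣) {i j : Fin m} (hij : i ≠ j)
    (hi : LieAlgebra.IsSimple ℝ (𝔣 i)) : 𝔣 i ⊓ 𝔣 j = ⊥ := by
  refine (eq_bot_or_eq_of_le_of_isSimple hi inf_le_left).resolve_right fun h => ?_
  have hle : 𝔣 i ≤ 𝔣 j := inf_eq_left.1 h
  rcases h𝔣.isSimple_or j with hj | hj
  · exact (eq_bot_or_eq_of_le_of_isSimple hj hle).elim (h𝔣.ne_bot i)
      fun h => hij (h𝔣.injective h)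
  · exact hi.non_abelian (LieAlgebra.abelian_of_le_center ℝ 𝔨 _ (hj.1 ▸ hle))

theorem isSimple_of_ne (h𝔣 : IsIdealDecomposition 𝔨 𝔣) {i j : Fin m} (hij : i ≠ j) :
    LieAlgebra.IsSimple ℝ (𝔣 i) ∨ LieAlgebra.IsSimple ℝ (𝔣 j) := by
  rcases h𝔣.isSimple_or i with hi | hi
  · exact Or.inl hi
  · refine Or.inr ((h𝔣.isSimple_or j).resolve_right fun hj => hij ?_)
    exact h𝔣.injective (hi.1.trans hj.1.symm)

theorem lie_eq_zero (h𝔣 : IsIdealDecomposition 𝔨 𝔣) {i j : Fin m} (hij : i ≠ j) {X Y : 𝔨}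
    (hX : X ∈ 𝔣 i) (hY : Y ∈ 𝔣 j) : ⁅X, Y⁆ = 0 := by
  have hd : 𝔣 i ⊓ 𝔣 j = ⊥ := by
    rcases h𝔣.isSimple_of_ne hij with h | h
    · exact h𝔣.disjoint_of_isSimple hij h
    · rw [inf_comm]
      exact h𝔣.disjoint_of_isSimple hij.symm h
  have hm : ⁅X, Y⁆ ∈ 𝔣 i ⊓ 𝔣 j :=
    (LieSubmodule.mem_inf _ _ _).2 ⟨lie_mem_left ℝ 𝔨 _ X Y hX, lie_mem_right ℝ 𝔨 _ X Y hY⟩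
  rwa [hd, LieSubmodule.mem_bot] at hm

/-- Distinct ideals are orthogonal with respect to every invariant symmetric form. -/
theorem form_eq_zero (h𝔣 : IsIdealDecomposition 𝔨 𝔣) {i j : Fin m} (hij : i ≠ j)
    (h : LinearMap.BilinForm ℝ 𝔨) (hsymm : ∀ X Y, h X Y = h Y X)
    (hinv : ∀ X Y Z : 𝔨, h ⁅X, Y⁆ Z = -h Y ⁅X, Z⁆) {X Y : 𝔨} (hX : X ∈ 𝔣 i) (hY : Y ∈ 𝔣 j) :
    h X Y = 0 := by
  rcases h𝔣.isSimple_of_ne hij with hs | hs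
  · exact form_eq_zero_of_isSimple hs (fun X hX Y hY => h𝔣.lie_eq_zero hij hX hY) h hinv hX hY
  · rw [hsymm]
    exact form_eq_zero_of_isSimple hs (fun X hX Y hY => h𝔣.lie_eq_zero hij.symm hX hY) h hinv hY hX

variable [FiniteDimensional ℝ L]

theorem iSup_eq_top (h𝔣 : IsIdealDecomposition 𝔨 𝔣) (hC : IsCartanDecomposition 𝔨) :
    ⨆ i, 𝔣 i = ⊤ := by
  refine hC.isInvariantInner.eq_top_of_forall_le _ ?_ fun A hA => ?_
  · by_cases h : LieAlgebra.center ℝ 𝔨 = ⊥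
    · exact h.le.trans bot_le
    · obtain ⟨i, hi⟩ := (h𝔣.mem_range _).2 (Or.inr ⟨rfl, h⟩)
      exact hi ▸ le_iSup 𝔣 i
  · obtain ⟨i, hi⟩ := (h𝔣.mem_range _).2 (Or.inl hA)
    exact hi ▸ le_iSup 𝔣 i

/-- The ideal `𝔣 i` is an irreducible `𝔣 i`-module. -/
theorem eq_top_of_invariant (h𝔣 : IsIdealDecomposition 𝔨 𝔣) (hC : IsCartanDecomposition 𝔨)
    (hL : LieAlgebra.IsSimple ℝ L) (hp : complP 𝔨 ≠ ⊥) (i : Fin m)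
    (W : Submodule ℝ (𝔣 i)) (hW : ∀ X : 𝔣 i, ∀ Y ∈ W, ⁅X, Y⁆ ∈ W) (hne : W ≠ ⊥) : W = ⊤ := by
  rcases h𝔣.isSimple_or i with hs | hs
  · let I : LieIdeal ℝ (𝔣 i) := { toSubmodule := W, lie_mem := fun {X Y} hY => hW X Y hY }
    have hI : I.toSubmodule = W := rfl
    rcases hs.eq_bot_or_eq_top I with h | h
    · exact absurd (by rw [← hI, h, LieSubmodule.bot_toSubmodule]) hne
    · rw [← hI, h, LieSubmodule.top_toSubmodule]
  · obtain ⟨U, hU, hU0⟩ := W.exists_mem_ne_zero_of_ne_bot hne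
    refine eq_top_iff.2 fun V _ => ?_
    obtain ⟨c, hc⟩ := hC.exists_smul_eq_of_mem_center hL hp (U := U) (V := V)
      (hs.1 ▸ U.2) (hs.1 ▸ V.2) (by simpa using hU0)
    have : V = c • U := Subtype.ext hc
    rw [this]
    exact W.smul_mem c hU

/-- Schur's lemma for the adjoint module. A simple ideal is irreducible by definition; the centre is
irreducible because it is a line, which matters as invariance says nothing there. -/
theorem exists_form_eq_mul (h𝔣 : IsIdealDecomposition 𝔨 𝔣) (hC : IsCartanDecomposition 𝔨)
    (hL : LieAlgebra.IsSimple ℝ L) (hp : complP 𝔨 ≠ ⊥) (i : Fin m)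
    (h : LinearMap.BilinForm ℝ (𝔣 i)) (hsymm : ∀ X Y, h X Y = h Y X)
    (hinv : ∀ X Y Z : 𝔣 i, h ⁅X, Y⁆ Z = -h Y ⁅X, Z⁆) :
    ∃ c : ℝ, ∀ X Y : 𝔣 i, h X Y = c * killingForm ℝ L (X : 𝔨) (Y : 𝔨) := by
  have := h𝔣.nontrivial i
  have hq := hC.isInvariantInner
  obtain ⟨c, hc⟩ := NatRed.exists_form_eq_mul ((compactForm 𝔨).restrict (𝔣 i).toSubmodule) h
    (fun X Y => hq.symm _ _) (fun X hX => hq.pos X (by simpa using hX)) hsymm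
    (Set.range fun X => (LieAlgebra.ad ℝ (𝔣 i) X : 𝔣 i →ₗ[ℝ] 𝔣 i))
    (by rintro _ ⟨Z, rfl⟩ X Y; exact hq.inv _ _ _)
    (by rintro _ ⟨Z, rfl⟩ X Y; exact hinv _ _ _) (fun W hW hne =>
      h𝔣.eq_top_of_invariant hC hL hp i W (fun X Y hY => hW _ ⟨X, rfl⟩ Y hY) hne)
  refine ⟨-c, fun X Y => ?_⟩
  rw [hc]
  change c * -killingForm ℝ L (X : 𝔨) (Y : 𝔨) = _
  ring

/-- The Killing form of `𝔣 i` is a multiple of the Killing form of `L`. -/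
theorem exists_killingForm_eq_mul (h𝔣 : IsIdealDecomposition 𝔨 𝔣) (hC : IsCartanDecomposition 𝔨)
    (hL : LieAlgebra.IsSimple ℝ L) (hp : complP 𝔨 ≠ ⊥) :
    ∃ κ : Fin m → ℝ, ∀ i, ∀ X Y : 𝔣 i,
      killingForm ℝ (𝔣 i) X Y = κ i * killingForm ℝ L (X : 𝔨) (Y : 𝔨) := by
  choose κ hκ using fun i => h𝔣.exists_form_eq_mul hC hL hp i (killingForm ℝ (𝔣 i))
    killingForm_symm killingForm_inv
  exact ⟨κ, hκ⟩

end IsIdealDecomposition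

end Ideals

/-! ### Bases adapted to the decomposition `L = 𝔭 ⊕ 𝔣 0 ⊕ ⋯ ⊕ 𝔣 (m - 1)` -/

/-- The Killing form in a basis that is orthonormal for a form with respect to which `ad X` is
skew. -/
theorem killingForm_self_eq_neg_sum {R : Type*} [LieRing R] [LieAlgebra ℝ R] {ι : Type*}
    [Fintype ι] [DecidableEq ι] {q : LinearMap.BilinForm ℝ R} {b : Module.Basis ι ℝ R}
    (hb : IsOrthonormalFor q b) (X : R) (hX : ∀ Y Z : R, q ⁅X, Y⁆ Z = -q Y ⁅X, Z⁆) :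
    killingForm ℝ R X X = -∑ j, ∑ k, q ⁅X, b j⁆ (b k) ^ 2 := by
  rw [killingForm_apply_apply, hb.trace_eq, ← Finset.sum_neg_distrib]
  refine Finset.sum_congr rfl fun j _ => ?_
  rw [LinearMap.comp_apply, LieAlgebra.ad_apply, LieAlgebra.ad_apply, hX, hb.sum_mul]
  simp_rw [pow_two]

section Adapted

variable {L : Type*} [LieRing L] [LieAlgebra ℝ L] {𝔨 : LieSubalgebra ℝ L} {m : ℕ}

/-- The index set of a basis of `L` adapted to `L = 𝔭 ⊕ 𝔣 0 ⊕ ⋯ ⊕ 𝔣 (m - 1)`. -/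
abbrev BlockIndex (𝔣 : Fin m → LieIdeal ℝ 𝔨) : Type :=
  Fin (Module.finrank ℝ (complP 𝔨)) ⊕ (Σ a : Fin m, Fin (Module.finrank ℝ (𝔣 a)))

/-- A basis of `L` that consists of orthonormal bases of `𝔭` and of the `𝔣 a`, with respect to the
Killing form and its negative, respectively. -/
structure AdaptedBasis (𝔣 : Fin m → LieIdeal ℝ 𝔨) where
  /-- the basis of `L` -/
  basis : Module.Basis (BlockIndex 𝔣) ℝ L
  /-- the basis of `𝔣 a` -/
  ideal : (a : Fin m) → Module.Basis (Fin (Module.finrank ℝ (𝔣 a))) ℝ (𝔣 a)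
  mem_complP : ∀ i, basis (Sum.inl i) ∈ complP 𝔨
  inr_eq : ∀ p, basis (Sum.inr p) = ((ideal p.1 p.2 : 𝔨) : L)
  killing : ∀ i j, killingForm ℝ L (basis i) (basis j) =
    if i = j then Sum.elim (fun _ => (1 : ℝ)) (fun _ => -1) i else 0

/-- The block of an index: `none` stands for `𝔭`, and `some a` for `𝔣 a`. -/
def blockOf {𝔣 : Fin m → LieIdeal ℝ 𝔨} : BlockIndex 𝔣 → Option (Fin m) :=
  Sum.elim (fun _ => none) (fun p => some p.1)

/-- The weight of a block. -/
def blockWeight (x : ℝ) (y : Fin m → ℝ) : Option (Fin m) → ℝ := fun o => o.elim x y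

/-- The sign of the Killing form on a block. -/
def blockSign : Option (Fin m) → ℝ := blockWeight 1 fun _ => -1

variable {𝔣 : Fin m → LieIdeal ℝ 𝔨}

@[simp] theorem blockOf_inl (i : Fin (Module.finrank ℝ (complP 𝔨))) :
    blockOf (𝔣 := 𝔣) (Sum.inl i) = none := rfl

@[simp] theorem blockOf_inr (p : Σ a : Fin m, Fin (Module.finrank ℝ (𝔣 a))) :
    blockOf (𝔣 := 𝔣) (Sum.inr p) = some p.1 := rfl

@[simp] theorem blockWeight_none (x : ℝ) (y : Fin m → ℝ) : blockWeight x y none = x := rfl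

@[simp] theorem blockWeight_some (x : ℝ) (y : Fin m → ℝ) (a : Fin m) :
    blockWeight x y (some a) = y a := rfl

@[simp] theorem blockSign_none : blockSign (m := m) none = 1 := rfl

@[simp] theorem blockSign_some (a : Fin m) : blockSign (some a) = -1 := rfl

theorem blockSign_mul_self (o : Option (Fin m)) : blockSign o * blockSign o = 1 := by
  cases o <;> simp

theorem blockWeight_pos {x : ℝ} {y : Fin m → ℝ} (hx : 0 < x) (hy : ∀ a, 0 < y a)
    (o : Option (Fin m)) : 0 < blockWeight x y o := by
  cases o
  · exact hx
  · exact hy _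

/-- Orthonormal bases of the blocks are independent together because the blocks are orthogonal for
the Killing form, and they span because the ideals exhaust `𝔨` (`iSup_eq_top`). -/
theorem exists_adaptedBasis [FiniteDimensional ℝ L] (hC : IsCartanDecomposition 𝔨)
    (h𝔣 : IsIdealDecomposition 𝔨 𝔣) : Nonempty (AdaptedBasis 𝔣) := by
  have hq := hC.isInvariantInner
  obtain ⟨bp, hbp⟩ := exists_isOrthonormalFor ((killingForm ℝ L).restrict (complP 𝔨))
    (fun X Y => killingForm_symm _ _) (fun X hX => hC.pos_on_p X X.2 (by simpa using hX))
  have hbk' : ∀ a, ∃ b : Module.Basis (Fin (Module.finrank ℝ (𝔣 a))) ℝ (𝔣 a),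
      IsOrthonormalFor ((compactForm 𝔨).restrict (𝔣 a).toSubmodule) b := fun a =>
    exists_isOrthonormalFor ((compactForm 𝔨).restrict (𝔣 a).toSubmodule)
      (fun X Y => hq.symm _ _) (fun X hX => hq.pos X (by simpa using hX))
  choose bk hbk using hbk'
  let v : BlockIndex 𝔣 → L := Sum.elim (fun i => (bp i : L)) (fun p => ((bk p.1 p.2 : 𝔨) : L))
  have hp : ∀ i j, killingForm ℝ L (bp i) (bp j) = if i = j then (1 : ℝ) else 0 := hbp
  have hk : ∀ a i j, -killingForm ℝ L (bk a i : 𝔨) (bk a j : 𝔨) = if i = j then (1 : ℝ) else 0 :=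
    fun a => hbk a
  have hv : ∀ i j, killingForm ℝ L (v i) (v j) =
      if i = j then Sum.elim (fun _ => (1 : ℝ)) (fun _ => -1) i else 0 := by
    rintro (i | ⟨a, i⟩) (j | ⟨a', j⟩)
    · simp [v, hp]
    · simp only [v, Sum.elim_inl, Sum.elim_inr, reduceCtorEq, if_false]
      exact killingForm_eq_zero_of_mem' (SetLike.coe_mem _) (bp i).2
    · simp only [v, Sum.elim_inl, Sum.elim_inr, reduceCtorEq, if_false]
      exact killingForm_eq_zero_of_mem (SetLike.coe_mem _) (bp j).2
    · simp only [v, Sum.elim_inr]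
      rcases eq_or_ne a a' with rfl | hne
      · rw [← neg_neg (killingForm ℝ L _ _), hk]
        simp only [Sum.inr.injEq, Sigma.mk.injEq, heq_eq_eq, true_and]
        split_ifs <;> simp
      · have h0 := h𝔣.form_eq_zero hne (compactForm 𝔨) hq.symm hq.inv (bk a i).2 (bk a' j).2
        rw [compactForm_apply, neg_eq_zero] at h0
        simp [h0, hne]
  have hli : LinearIndependent ℝ v := by
    refine LinearMap.BilinForm.linearIndependent_of_iIsOrtho (B := killingForm ℝ L)
      (fun i j hij => ?_) fun i => ?_
    · change killingForm ℝ L (v i) (v j) = 0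
      rw [hv, if_neg hij]
    · rw [hv, if_pos rfl]
      cases i <;> simp
  have hspan : ⊤ ≤ Submodule.span ℝ (Set.range v) := by
    intro X _
    obtain ⟨Z, hZ, Y, hY, rfl⟩ := hC.exists_add X
    refine add_mem ?_ ?_
    · have h1 : ∀ a, (𝔣 a).toSubmodule ≤
          (Submodule.span ℝ (Set.range v)).comap 𝔨.toSubmodule.subtype := fun a U hU => by
        have h2 : (⊤ : Submodule ℝ (𝔣 a)) ≤ ((Submodule.span ℝ (Set.range v)).comap
            𝔨.toSubmodule.subtype).comap (𝔣 a).toSubmodule.subtype := by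
          rw [← (bk a).span_eq, Submodule.span_le]
          rintro _ ⟨i, rfl⟩
          exact Submodule.subset_span ⟨Sum.inr ⟨a, i⟩, rfl⟩
        exact h2 (Submodule.mem_top (x := (⟨U, hU⟩ : 𝔣 a)))
      have h3 := iSup_le h1
      rw [LieSubmodule.iSup_toSubmodule_eq_top.2 (h𝔣.iSup_eq_top hC)] at h3
      exact h3 (Submodule.mem_top (x := (⟨Z, hZ⟩ : 𝔨)))
    · have h2 : (⊤ : Submodule ℝ (complP 𝔨)) ≤ (Submodule.span ℝ (Set.range v)).comap
          (complP 𝔨).subtype := by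
        rw [← bp.span_eq, Submodule.span_le]
        rintro _ ⟨i, rfl⟩
        exact Submodule.subset_span ⟨Sum.inl i, rfl⟩
      exact h2 (Submodule.mem_top (x := (⟨Y, hY⟩ : complP 𝔨)))
  refine ⟨⟨Module.Basis.mk hli hspan, bk, fun i => ?_, fun p => ?_, fun i j => ?_⟩⟩
  · rw [Module.Basis.mk_apply]
    exact (bp i).2
  · rw [Module.Basis.mk_apply]
    rfl
  · rw [Module.Basis.mk_apply, Module.Basis.mk_apply, hv]

namespace AdaptedBasis

variable (e : AdaptedBasis 𝔣)

theorem killing_eq (i j : BlockIndex 𝔣) : killingForm ℝ L (e.basis i) (e.basis j) =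
    if i = j then blockSign (blockOf i) else 0 := by
  rw [e.killing]
  cases i <;> rfl

theorem inr_mem (p : Σ a : Fin m, Fin (Module.finrank ℝ (𝔣 a))) : e.basis (Sum.inr p) ∈ 𝔨 := by
  rw [e.inr_eq]
  exact SetLike.coe_mem _

/-- The structure constants of `L` in an adapted basis, with lowered index. -/
def str (i j k : BlockIndex 𝔣) : ℝ := killingForm ℝ L ⁅e.basis i, e.basis j⁆ (e.basis k)

theorem str_swap (i j k : BlockIndex 𝔣) : e.str i j k = -e.str j i k := by
  rw [str, str, ← lie_skew, map_neg, LinearMap.neg_apply]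

/-- Together with `str_swap` this makes the lowered constants totally antisymmetric, so each
vanishing statement may be moved to any position. -/
theorem str_swap' (i j k : BlockIndex 𝔣) : e.str i j k = -e.str i k j := by
  rw [str, str, killingForm_inv, killingForm_symm]

/-- The form that is diagonal in the basis `e`, with values depending on the block only. -/
def IsDiag (h : LinearMap.BilinForm ℝ L) (x : ℝ) (y : Fin m → ℝ) : Prop :=
  ∀ i j, h (e.basis i) (e.basis j) = if i = j then blockWeight x y (blockOf i) else 0

variable {e}

theorem IsDiag.apply_basis {h : LinearMap.BilinForm ℝ L} {x : ℝ} {y : Fin m → ℝ}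
    (hh : e.IsDiag h x y) (X : L) (k : BlockIndex 𝔣) : h X (e.basis k) =
      blockWeight x y (blockOf k) * blockSign (blockOf k) * killingForm ℝ L X (e.basis k) := by
  have heq : LinearMap.flip h (e.basis k) = (blockWeight x y (blockOf k) * blockSign (blockOf k)) •
      LinearMap.flip (killingForm ℝ L) (e.basis k) := by
    refine e.basis.ext fun i => ?_
    simp only [LinearMap.smul_apply, LinearMap.flip_apply, smul_eq_mul]
    rw [hh i k, e.killing_eq]
    split_ifs with hik
    · subst hik
      rw [mul_assoc, blockSign_mul_self, mul_one]
    · simp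
  exact LinearMap.congr_fun heq X

theorem IsDiag.symm {h : LinearMap.BilinForm ℝ L} {x : ℝ} {y : Fin m → ℝ}
    (hh : e.IsDiag h x y) (X Y : L) : h X Y = h Y X := by
  have : h = LinearMap.flip h := LinearMap.BilinForm.ext_basis e.basis fun i j => by
    rw [LinearMap.flip_apply, hh i j, hh j i]
    by_cases hij : i = j
    · rw [hij]
    · rw [if_neg hij, if_neg (Ne.symm hij)]
  conv_lhs => rw [this]
  rfl

variable (e)

/-- Each block is stable under `ad Z`, and distinct blocks are orthogonal. -/
theorem killing_lie_eq_zero (h𝔣 : IsIdealDecomposition 𝔨 𝔣) (hC : IsCartanDecomposition 𝔨)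
    {Z : L} (hZ : Z ∈ 𝔨) {j k : BlockIndex 𝔣} (hjk : blockOf j ≠ blockOf k) :
    killingForm ℝ L ⁅Z, e.basis j⁆ (e.basis k) = 0 := by
  rcases j with j | j <;> rcases k with k | k
  · exact absurd rfl hjk
  · exact killingForm_eq_zero_of_mem' (e.inr_mem k) (lie_mem_complP hZ (e.mem_complP j))
  · exact killingForm_eq_zero_of_mem (𝔨.lie_mem hZ (e.inr_mem j)) (e.mem_complP k)
  · have hq := hC.isInvariantInner
    have hne : j.1 ≠ k.1 := fun h => hjk (congrArg some h)
    have h0 := h𝔣.form_eq_zero hne (compactForm 𝔨) hq.symm hq.inv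
      (lie_mem_right ℝ 𝔨 _ ⟨Z, hZ⟩ _ (e.ideal j.1 j.2).2) (e.ideal k.1 k.2).2
    rw [compactForm_apply, neg_eq_zero] at h0
    rw [e.inr_eq, e.inr_eq]
    exact h0

theorem str_inr_eq_zero (h𝔣 : IsIdealDecomposition 𝔨 𝔣) (hC : IsCartanDecomposition 𝔨)
    (p : Σ a : Fin m, Fin (Module.finrank ℝ (𝔣 a))) {j k : BlockIndex 𝔣}
    (hjk : blockOf j ≠ blockOf k) : e.str (Sum.inr p) j k = 0 :=
  e.killing_lie_eq_zero h𝔣 hC (e.inr_mem p) hjk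

theorem str_inl_inl_inl (hC : IsCartanDecomposition 𝔨)
    (i j k : Fin (Module.finrank ℝ (complP 𝔨))) :
    e.str (Sum.inl i) (Sum.inl j) (Sum.inl k) = 0 :=
  killingForm_eq_zero_of_mem (hC.lie_p_p _ (e.mem_complP i) _ (e.mem_complP j)) (e.mem_complP k)

/-- Diagonal forms are invariant under `𝔨`. -/
theorem IsDiag.inv {e : AdaptedBasis 𝔣} (h𝔣 : IsIdealDecomposition 𝔨 𝔣)
    (hC : IsCartanDecomposition 𝔨) {h : LinearMap.BilinForm ℝ L} {x : ℝ} {y : Fin m → ℝ}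
    (hh : e.IsDiag h x y) {Z : L} (hZ : Z ∈ 𝔨) (X Y : L) : h ⁅Z, X⁆ Y = -h X ⁅Z, Y⁆ := by
  have heq : h ∘ₗ (LieAlgebra.ad ℝ L Z : L →ₗ[ℝ] L) =
      -(h.compl₂ (LieAlgebra.ad ℝ L Z : L →ₗ[ℝ] L)) :=
    LinearMap.BilinForm.ext_basis e.basis fun j k => by
      change h ⁅Z, e.basis j⁆ (e.basis k) = -h (e.basis j) ⁅Z, e.basis k⁆
      rw [hh.symm (e.basis j), hh.apply_basis, hh.apply_basis, killingForm_inv,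
        killingForm_symm (e.basis j)]
      by_cases hjk : blockOf k = blockOf j
      · rw [hjk]
        ring
      · rw [e.killing_lie_eq_zero h𝔣 hC hZ hjk]
        ring
  exact LinearMap.congr_fun (LinearMap.congr_fun heq X) Y

/-- The form `x Q|_𝔭 + ∑ a, y a Q|_(𝔣 a)`. -/
def blockForm (x : ℝ) (y : Fin m → ℝ) : LinearMap.BilinForm ℝ L :=
  ∑ i, blockWeight x y (blockOf i) • (e.basis.coord i).smulRight (e.basis.coord i)

theorem blockForm_apply (x : ℝ) (y : Fin m → ℝ) (X Y : L) : e.blockForm x y X Y =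
    ∑ i, blockWeight x y (blockOf i) * (e.basis.repr X i * e.basis.repr Y i) := by
  simp [blockForm, LinearMap.sum_apply]

theorem isDiag_blockForm (x : ℝ) (y : Fin m → ℝ) : e.IsDiag (e.blockForm x y) x y := by
  intro i j
  rw [blockForm_apply, Finset.sum_eq_single i]
  · by_cases hij : i = j
    · simp [hij]
    · simp [hij]
  · intro k _ hk
    simp [Finsupp.single_apply, Ne.symm hk]
  · simp

theorem IsDiag.eq_blockForm {e : AdaptedBasis 𝔣} {h : LinearMap.BilinForm ℝ L} {x : ℝ}
    {y : Fin m → ℝ} (hh : e.IsDiag h x y) : h = e.blockForm x y :=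
  LinearMap.BilinForm.ext_basis e.basis fun i j => by rw [hh i j, e.isDiag_blockForm x y i j]

/-- The metric `x Q|_𝔭 + ∑ a, y a Q|_(𝔣 a)`. -/
def blockMetric {x : ℝ} {y : Fin m → ℝ} (hx : 0 < x) (hy : ∀ a, 0 < y a) : InvMetric L where
  form := e.blockForm x y
  symm := (e.isDiag_blockForm x y).symm
  pos X hX := by
    rw [blockForm_apply]
    have hne : e.basis.repr X ≠ 0 := by simpa using hX
    obtain ⟨i, hi⟩ := Finsupp.ne_iff.1 hne
    refine Finset.sum_pos' (fun j _ => ?_) ⟨i, Finset.mem_univ i, ?_⟩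
    · exact mul_nonneg (blockWeight_pos hx hy _).le (mul_self_nonneg _)
    · exact mul_pos (blockWeight_pos hx hy _) (mul_self_pos.2 hi)

theorem isDiag_of_hasBlockForm {h : LinearMap.BilinForm ℝ L} {u : ℝ} {v : Fin m → ℝ}
    (hh : HasBlockForm 𝔣 h u v) : e.IsDiag h u v := by
  have hsum : ∀ (a : Fin m) (U : 𝔣 a),
      ∑ b, (((Pi.single a U : (b : Fin m) → 𝔣 b) b : 𝔨) : L) = (U : 𝔨) := fun a U => by
    rw [Finset.sum_eq_single a]
    · simp
    · intro b _ hb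
      simp [Pi.single_eq_of_ne hb]
    · simp
  rintro (i | p) (j | p')
  · have := hh _ (e.mem_complP i) _ (e.mem_complP j) 0 0
    simp only [Pi.zero_apply, ZeroMemClass.coe_zero, Finset.sum_const_zero, add_zero, map_zero,
      neg_zero, mul_zero, e.killing] at this
    rw [this]
    by_cases hij : i = j <;> simp [hij]
  · have := hh _ (e.mem_complP i) 0 (zero_mem _) 0 (Pi.single p'.1 (e.ideal p'.1 p'.2))
    rw [hsum, ← e.inr_eq] at this
    simpa using this
  · have := hh 0 (zero_mem _) _ (e.mem_complP j) (Pi.single p.1 (e.ideal p.1 p.2)) 0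
    rw [hsum, ← e.inr_eq] at this
    simpa using this
  · have := hh 0 (zero_mem _) 0 (zero_mem _) (Pi.single p.1 (e.ideal p.1 p.2))
      (Pi.single p'.1 (e.ideal p'.1 p'.2))
    rw [hsum, hsum, ← e.inr_eq, ← e.inr_eq, zero_add, zero_add] at this
    rw [this, map_zero, mul_zero, zero_add, Finset.sum_eq_single p.1]
    · by_cases hpp : p'.1 = p.1
      · obtain ⟨a, i⟩ := p
        obtain ⟨a', i'⟩ := p'
        obtain rfl : a' = a := hpp
        have hk := e.killing (Sum.inr ⟨a', i⟩) (Sum.inr ⟨a', i'⟩)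
        rw [e.inr_eq, e.inr_eq] at hk
        rw [Pi.single_eq_same, Pi.single_eq_same, hk]
        split_ifs <;> simp
      · have hne : p ≠ p' := fun h => hpp (by rw [h])
        rw [Pi.single_eq_of_ne (Ne.symm hpp)]
        simp [hne]
    · intro b _ hb
      simp [Pi.single_eq_of_ne hb]
    · simp

end AdaptedBasis

end Adapted

/-! ### The scalar curvature of the metrics `x Q|_𝔭 + ∑ a, y a Q|_(𝔣 a)` -/

namespace AdaptedBasis

variable {L : Type*} [LieRing L] [LieAlgebra ℝ L] {𝔨 : LieSubalgebra ℝ L} {m : ℕ}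
  {𝔣 : Fin m → LieIdeal ℝ 𝔨} (e : AdaptedBasis 𝔣)

/-- The basis that results from `e` by normalizing with respect to a diagonal metric. -/
def scaled {x : ℝ} {y : Fin m → ℝ} (hx : 0 < x) (hy : ∀ a, 0 < y a) :
    Module.Basis (BlockIndex 𝔣) ℝ L :=
  e.basis.isUnitSMul (w := fun i => (Real.sqrt (blockWeight x y (blockOf i)))⁻¹)
    fun i => (inv_ne_zero (Real.sqrt_pos.2 (blockWeight_pos hx hy (blockOf i))).ne').isUnit

variable {e} {x : ℝ} {y : Fin m → ℝ}

theorem scaled_apply (hx : 0 < x) (hy : ∀ a, 0 < y a) (i : BlockIndex 𝔣) :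
    e.scaled hx hy i = (Real.sqrt (blockWeight x y (blockOf i)))⁻¹ • e.basis i :=
  Module.Basis.isUnitSMul_apply _ _

theorem sqrt_inv_mul_self (hx : 0 < x) (hy : ∀ a, 0 < y a) (o : Option (Fin m)) :
    (Real.sqrt (blockWeight x y o))⁻¹ * (Real.sqrt (blockWeight x y o))⁻¹ =
      (blockWeight x y o)⁻¹ := by
  rw [← mul_inv, Real.mul_self_sqrt (blockWeight_pos hx hy o).le]

theorem IsDiag.apply_scaled {h : LinearMap.BilinForm ℝ L} {u : ℝ} {v : Fin m → ℝ}
    (hh : e.IsDiag h u v) (hx : 0 < x) (hy : ∀ a, 0 < y a) (i : BlockIndex 𝔣) :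
    h (e.scaled hx hy i) (e.scaled hx hy i) =
      blockWeight u v (blockOf i) / blockWeight x y (blockOf i) := by
  rw [scaled_apply, map_smul, map_smul, LinearMap.smul_apply, hh i i, if_pos rfl, smul_eq_mul,
    smul_eq_mul, ← mul_assoc, sqrt_inv_mul_self hx hy]
  ring

theorem IsDiag.isOrthonormalFor {h : LinearMap.BilinForm ℝ L} (hh : e.IsDiag h x y) (hx : 0 < x)
    (hy : ∀ a, 0 < y a) : IsOrthonormalFor h (e.scaled hx hy) := by
  intro i j
  by_cases hij : i = j
  · subst hij
    rw [if_pos rfl, hh.apply_scaled hx hy, div_self (blockWeight_pos hx hy _).ne']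
  · rw [if_neg hij, scaled_apply, scaled_apply, map_smul, map_smul, LinearMap.smul_apply, hh i j,
      if_neg hij]
    simp

theorem sum_blockIndex (F : Option (Fin m) → ℝ) : ∑ i : BlockIndex 𝔣, F (blockOf i) =
    Module.finrank ℝ (complP 𝔨) * F none + ∑ a, Module.finrank ℝ (𝔣 a) * F (some a) := by
  rw [Fintype.sum_sum_type, Fintype.sum_sigma]
  simp

/-- The trace of a diagonal form with respect to a diagonal metric. -/
theorem tr_eq [FiniteDimensional ℝ L] {g : InvMetric L} (hg : e.IsDiag g.form x y) (hx : 0 < x)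
    (hy : ∀ a, 0 < y a) {h : LinearMap.BilinForm ℝ L} {u : ℝ} {v : Fin m → ℝ}
    (hh : e.IsDiag h u v) : g.tr h = Module.finrank ℝ (complP 𝔨) * (u / x) +
      ∑ a, Module.finrank ℝ (𝔣 a) * (v a / y a) := by
  rw [g.tr_eq_sum (hg.isOrthonormalFor hx hy)]
  simp_rw [hh.apply_scaled hx hy]
  exact sum_blockIndex fun o => blockWeight u v o / blockWeight x y o

/-- Squaring removes the signs of the Killing form, so the metric enters only through the block
weights. -/
theorem form_lie_scaled_sq {h : LinearMap.BilinForm ℝ L} (hh : e.IsDiag h x y) (hx : 0 < x)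
    (hy : ∀ a, 0 < y a) (i j k : BlockIndex 𝔣) :
    h ⁅e.scaled hx hy i, e.scaled hx hy j⁆ (e.scaled hx hy k) ^ 2 =
      e.str i j k ^ 2 * (blockWeight x y (blockOf k) /
        (blockWeight x y (blockOf i) * blockWeight x y (blockOf j))) := by
  have hpos := fun i : BlockIndex 𝔣 => blockWeight_pos hx hy (blockOf i)
  simp only [scaled_apply, smul_lie, lie_smul, map_smul, LinearMap.smul_apply, smul_eq_mul]
  rw [hh.apply_basis, ← str]
  have hs := blockSign_mul_self (blockOf k)
  have h1 := sqrt_inv_mul_self hx hy (blockOf i)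
  have h2 := sqrt_inv_mul_self hx hy (blockOf j)
  have h3 := sqrt_inv_mul_self hx hy (blockOf k)
  have hi := (hpos i).ne'
  have hj := (hpos j).ne'
  have hk := (hpos k).ne'
  generalize blockWeight x y (blockOf i) = wi at *
  generalize blockWeight x y (blockOf j) = wj at *
  generalize blockWeight x y (blockOf k) = wk at *
  generalize (Real.sqrt wi)⁻¹ = si at *
  generalize (Real.sqrt wj)⁻¹ = sj at *
  generalize (Real.sqrt wk)⁻¹ = sk at *
  generalize blockSign (blockOf k) = s at *
  calc _ = (si * si) * (sj * sj) * (sk * sk) * (s * s) * (wk * wk) * e.str i j k ^ 2 := by ring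
    _ = _ := by
      rw [h1, h2, h3, hs]
      field_simp

theorem killing_lie_self_right (X Y : L) : killingForm ℝ L ⁅X, Y⁆ Y = 0 := by
  have h := killingForm_inv X Y Y
  rw [killingForm_symm Y] at h
  linarith

/-- Diagonal metrics have unimodular structure constants. -/
theorem form_lie_scaled_self {h : LinearMap.BilinForm ℝ L} (hh : e.IsDiag h x y) (hx : 0 < x)
    (hy : ∀ a, 0 < y a) (Z : L) (j : BlockIndex 𝔣) :
    h ⁅Z, e.scaled hx hy j⁆ (e.scaled hx hy j) = 0 := by
  simp only [scaled_apply, lie_smul, map_smul, LinearMap.smul_apply, smul_eq_mul]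
  rw [hh.apply_basis, killing_lie_self_right]
  simp

variable (e)

/-- The operator `ad Z` is skew for `Q`, so the Killing form at a unit vector of `𝔨`, which is `-1`,
is minus the sum of the squared matrix entries. -/
theorem sum_str_inr (h𝔣 : IsIdealDecomposition 𝔨 𝔣) (hC : IsCartanDecomposition 𝔨)
    (p : Σ a : Fin m, Fin (Module.finrank ℝ (𝔣 a))) :
    ∑ j, ∑ k, e.str (Sum.inr p) j k ^ 2 = 1 := by
  have hd := e.isDiag_blockForm 1 fun _ => 1
  have hw : ∀ o : Option (Fin m), blockWeight 1 (fun _ => 1) o = 1 := fun o => by cases o <;> rfl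
  have hb : IsOrthonormalFor (e.blockForm 1 fun _ => 1) e.basis := fun i j => by
    rw [hd i j, hw]
  have h := killingForm_self_eq_neg_sum hb (e.basis (Sum.inr p))
    (hd.inv h𝔣 hC (e.inr_mem p))
  rw [e.killing_eq, if_pos rfl, blockOf_inr, blockSign_some, neg_inj] at h
  rw [h]
  refine Finset.sum_congr rfl fun j _ => Finset.sum_congr rfl fun k _ => ?_
  rw [hd.apply_basis, hw, one_mul, mul_pow, ← str, pow_two (blockSign _), blockSign_mul_self,
    one_mul]

theorem orthonormal_ideal (a : Fin m) :
    IsOrthonormalFor ((compactForm 𝔨).restrict (𝔣 a).toSubmodule) (e.ideal a) := by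
  intro i j
  have h := e.killing (Sum.inr ⟨a, i⟩) (Sum.inr ⟨a, j⟩)
  rw [e.inr_eq, e.inr_eq] at h
  change -killingForm ℝ L (e.ideal a i : 𝔨) (e.ideal a j : 𝔨) = _
  rw [h]
  by_cases hij : i = j <;> simp [hij]

variable {κ : Fin m → ℝ}

/-- The part of the Casimir operator of `𝔣 a` that comes from `𝔣 a` itself. -/
theorem sum_str_inr_inr (h𝔣 : IsIdealDecomposition 𝔨 𝔣) (hC : IsCartanDecomposition 𝔨)
    (hκ : ∀ i, ∀ X Y : 𝔣 i,
      killingForm ℝ (𝔣 i) X Y = κ i * killingForm ℝ L (X : 𝔨) (Y : 𝔨))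
    (p : Σ a : Fin m, Fin (Module.finrank ℝ (𝔣 a))) :
    ∑ q, ∑ r, e.str (Sum.inr p) (Sum.inr q) (Sum.inr r) ^ 2 = κ p.1 := by
  obtain ⟨a, i⟩ := p
  have h := killingForm_self_eq_neg_sum (e.orthonormal_ideal a) (e.ideal a i)
    (fun Y Z => hC.isInvariantInner.inv _ _ _)
  have hk := e.killing (Sum.inr ⟨a, i⟩) (Sum.inr ⟨a, i⟩)
  rw [e.inr_eq, if_pos rfl] at hk
  rw [hκ, hk] at h
  have h1 : κ a = ∑ j, ∑ k, e.str (Sum.inr ⟨a, i⟩) (Sum.inr ⟨a, j⟩) (Sum.inr ⟨a, k⟩) ^ 2 := by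
    simp only [Sum.elim_inr, mul_neg, mul_one, neg_inj] at h
    rw [h]
    refine Finset.sum_congr rfl fun j _ => Finset.sum_congr rfl fun k _ => ?_
    rw [str, e.inr_eq, e.inr_eq, e.inr_eq, ← neg_sq (killingForm ℝ L _ _)]
    rfl
  have hne : ∀ q r : Σ a : Fin m, Fin (Module.finrank ℝ (𝔣 a)), q.1 ≠ r.1 →
      e.str (Sum.inr ⟨a, i⟩) (Sum.inr q) (Sum.inr r) = 0 := fun q r hqr =>
    e.str_inr_eq_zero h𝔣 hC _ fun h => hqr (Option.some_injective _ h)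
  have hne' : ∀ q r : Σ a : Fin m, Fin (Module.finrank ℝ (𝔣 a)), r.1 ≠ a →
      e.str (Sum.inr ⟨a, i⟩) (Sum.inr q) (Sum.inr r) = 0 := fun q r hqr => by
    rw [str_swap, e.str_inr_eq_zero h𝔣 hC q (j := Sum.inr ⟨a, i⟩) (k := Sum.inr r)
      (fun h => hqr (Option.some_injective _ h).symm), neg_zero]
  rw [h1, Fintype.sum_sigma, Finset.sum_eq_single a]
  · refine Finset.sum_congr rfl fun j _ => ?_
    rw [Fintype.sum_sigma, Finset.sum_eq_single a]
    · intro b _ hb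
      refine Finset.sum_eq_zero fun k _ => ?_
      rw [hne' _ _ hb, zero_pow two_ne_zero]
    · simp
  · intro b _ hb
    refine Finset.sum_eq_zero fun j _ => Finset.sum_eq_zero fun r _ => ?_
    by_cases hr : r.1 = a
    · rw [hne _ _ fun h => hb (h.trans hr), zero_pow two_ne_zero]
    · rw [hne' _ _ hr, zero_pow two_ne_zero]
  · simp

/-- The part of the Casimir operator of `𝔣 a` that comes from `𝔭`. -/
theorem sum_str_inl_inl (h𝔣 : IsIdealDecomposition 𝔨 𝔣) (hC : IsCartanDecomposition 𝔨)
    (hκ : ∀ i, ∀ X Y : 𝔣 i,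
      killingForm ℝ (𝔣 i) X Y = κ i * killingForm ℝ L (X : 𝔨) (Y : 𝔨))
    (p : Σ a : Fin m, Fin (Module.finrank ℝ (𝔣 a))) :
    ∑ j, ∑ k, e.str (Sum.inr p) (Sum.inl j) (Sum.inl k) ^ 2 = 1 - κ p.1 := by
  have h := e.sum_str_inr h𝔣 hC p
  rw [Fintype.sum_sum_type] at h
  simp only [Fintype.sum_sum_type, Finset.sum_add_distrib] at h
  rw [e.sum_str_inr_inr h𝔣 hC hκ] at h
  have h1 : ∑ j, ∑ q, e.str (Sum.inr p) (Sum.inl j) (Sum.inr q) ^ 2 = 0 :=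
    Finset.sum_eq_zero fun j _ => Finset.sum_eq_zero fun q _ => by
      rw [e.str_inr_eq_zero h𝔣 hC p (by simp), zero_pow two_ne_zero]
  have h2 : ∑ q, ∑ j, e.str (Sum.inr p) (Sum.inr q) (Sum.inl j) ^ 2 = 0 :=
    Finset.sum_eq_zero fun j _ => Finset.sum_eq_zero fun q _ => by
      rw [e.str_inr_eq_zero h𝔣 hC p (by simp), zero_pow two_ne_zero]
  rw [h1, h2] at h
  linarith

/-- The number `1 - κ a` is the sum of the squared matrix entries of a unit vector of `𝔣 a` acting
on `𝔭`. Were it not positive, that vector would kill `𝔭`, against the faithfulness of the action. -/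
theorem kappa_lt_one [FiniteDimensional ℝ L] (h𝔣 : IsIdealDecomposition 𝔨 𝔣)
    (hC : IsCartanDecomposition 𝔨) (hL : LieAlgebra.IsSimple ℝ L) (hp : complP 𝔨 ≠ ⊥)
    (hκ : ∀ i, ∀ X Y : 𝔣 i,
      killingForm ℝ (𝔣 i) X Y = κ i * killingForm ℝ L (X : 𝔨) (Y : 𝔨)) (a : Fin m) : κ a < 1 := by
  obtain ⟨e⟩ := exists_adaptedBasis hC h𝔣
  have := h𝔣.nontrivial a
  let i : Fin (Module.finrank ℝ (𝔣 a)) := ⟨0, Module.finrank_pos⟩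
  have h := e.sum_str_inl_inl h𝔣 hC hκ ⟨a, i⟩
  by_contra hge
  have h0 : ∀ j k, e.str (Sum.inr ⟨a, i⟩) (Sum.inl j) (Sum.inl k) = 0 := by
    have hs : ∑ j, ∑ k, e.str (Sum.inr ⟨a, i⟩) (Sum.inl j) (Sum.inl k) ^ 2 = 0 :=
      le_antisymm (by simp only at h; linarith)
        (Finset.sum_nonneg fun j _ => Finset.sum_nonneg fun k _ => sq_nonneg _)
    intro j k
    rw [Finset.sum_eq_zero_iff_of_nonneg fun j _ => Finset.sum_nonneg fun k _ => sq_nonneg _] at hs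
    have hj := hs j (Finset.mem_univ j)
    rw [Finset.sum_eq_zero_iff_of_nonneg fun k _ => sq_nonneg _] at hj
    exact pow_eq_zero_iff two_ne_zero |>.1 (hj k (Finset.mem_univ k))
  have hall : ∀ X, ⁅e.basis (Sum.inr ⟨a, i⟩), X⁆ ∈ 𝔨 := fun X => by
    have hle : (⊤ : Submodule ℝ L) ≤ 𝔨.toSubmodule.comap
        (LieAlgebra.ad ℝ L (e.basis (Sum.inr ⟨a, i⟩)) : L →ₗ[ℝ] L) := by
      rw [← e.basis.span_eq, Submodule.span_le]
      rintro _ ⟨j | q, rfl⟩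
      · have hz : ⁅e.basis (Sum.inr ⟨a, i⟩), e.basis (Sum.inl j)⁆ = 0 := by
          have hd := e.isDiag_blockForm 1 fun _ => 1
          refine (e.blockMetric one_pos fun _ => one_pos).eq_zero_of_form fun Z => ?_
          have hlin : (e.blockForm 1 fun _ => 1)
              ⁅e.basis (Sum.inr ⟨a, i⟩), e.basis (Sum.inl j)⁆ = 0 := by
            refine e.basis.ext fun k => ?_
            rw [hd.apply_basis, ← str]
            rcases k with k | k
            · rw [h0]
              simp
            · rw [e.str_inr_eq_zero h𝔣 hC _ (by simp)]
              simp
          exact LinearMap.congr_fun hlin Z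
        change ⁅e.basis (Sum.inr ⟨a, i⟩), e.basis (Sum.inl j)⁆ ∈ 𝔨
        rw [hz]
        exact zero_mem _
      · exact 𝔨.lie_mem (e.inr_mem _) (e.inr_mem q)
    exact hle (Submodule.mem_top (x := X))
  refine e.basis.ne_zero (Sum.inr ⟨a, i⟩) (hC.eq_zero_of_lie_eq_zero hL hp (e.inr_mem _)
    fun X hX => hC.eq_zero_of_mem (hall X) (lie_mem_complP (e.inr_mem _) hX))

variable {e}

/-- The scalar curvature of the metric `x Q|_𝔭 + ∑ a, y a Q|_(𝔣 a)`. -/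
theorem scal_eq [FiniteDimensional ℝ L] (h𝔣 : IsIdealDecomposition 𝔨 𝔣)
    (hC : IsCartanDecomposition 𝔨)
    (hκ : ∀ i, ∀ X Y : 𝔣 i,
      killingForm ℝ (𝔣 i) X Y = κ i * killingForm ℝ L (X : 𝔨) (Y : 𝔨))
    {g : InvMetric L} (hg : e.IsDiag g.form x y) (hx : 0 < x) (hy : ∀ a, 0 < y a) :
    g.scal = -(Module.finrank ℝ (complP 𝔨) / (2 * x)) + 1 / 4 * ∑ a, Module.finrank ℝ (𝔣 a) *
      (κ a / y a - (1 - κ a) * y a / x ^ 2) := by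
  have hb := hg.isOrthonormalFor hx hy
  rw [g.scal_eq hb fun Z => Finset.sum_eq_zero fun j _ => form_lie_scaled_self hg hx hy Z j]
  have hkil : e.IsDiag (killingForm ℝ L) 1 fun _ => -1 := fun i j => e.killing_eq i j
  simp_rw [hkil.apply_scaled hx hy, form_lie_scaled_sq hg hx hy]
  rw [sum_blockIndex fun o => blockWeight 1 (fun _ => -1) o / blockWeight x y o]
  have hx0 := hx.ne'
  have hy0 := fun a => (hy a).ne'
  have hK : ∀ p : Σ a : Fin m, Fin (Module.finrank ℝ (𝔣 a)), ∑ j, ∑ k,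
      e.str (Sum.inr p) j k ^ 2 * (blockWeight x y (blockOf k) /
        (blockWeight x y (blockOf (𝔣 := 𝔣) (Sum.inr p)) * blockWeight x y (blockOf j))) =
          1 / y p.1 := fun p => by
    -- An element of `𝔨` maps each block to itself, so the weights of `j` and `k` cancel wherever
    -- the constant is nonzero.
    have h1 : ∀ j k, e.str (Sum.inr p) j k ^ 2 * (blockWeight x y (blockOf k) /
        (blockWeight x y (blockOf (𝔣 := 𝔣) (Sum.inr p)) * blockWeight x y (blockOf j))) =
          e.str (Sum.inr p) j k ^ 2 * (1 / y p.1) := fun j k => by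
      by_cases hjk : blockOf j = blockOf k
      · have := (blockWeight_pos hx hy (blockOf k)).ne'
        have := hy0 p.1
        rw [hjk, blockOf_inr, blockWeight_some]
        field_simp
      · rw [e.str_inr_eq_zero h𝔣 hC p hjk]
        ring
    simp_rw [h1, ← Finset.sum_mul]
    rw [e.sum_str_inr h𝔣 hC p, one_mul]
  -- As `[𝔭, 𝔭] ⊆ 𝔨` and `[𝔭, 𝔨] ⊆ 𝔭`, exactly one of `j, k` belongs to `𝔨` in each nonzero term.
  -- The two cases carry the weights `1 / y` and `y / x ^ 2`.
  have hP : ∑ i, ∑ j, ∑ k, e.str (Sum.inl i) j k ^ 2 * (blockWeight x y (blockOf k) /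
      (blockWeight x y (blockOf (𝔣 := 𝔣) (Sum.inl i)) * blockWeight x y (blockOf j))) =
        ∑ p : Σ a : Fin m, Fin (Module.finrank ℝ (𝔣 a)),
          (1 - κ p.1) * (1 / y p.1 + y p.1 / x ^ 2) := by
    have hLL : ∀ i, ∑ j, ∑ k, e.str (Sum.inl i) (Sum.inl j) (Sum.inl k) ^ 2 *
        (blockWeight x y (blockOf (𝔣 := 𝔣) (Sum.inl k)) / (blockWeight x y
          (blockOf (𝔣 := 𝔣) (Sum.inl i)) * blockWeight x y (blockOf (𝔣 := 𝔣) (Sum.inl j)))) = 0 :=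
      fun i => Finset.sum_eq_zero fun j _ => Finset.sum_eq_zero fun k _ => by
        rw [e.str_inl_inl_inl hC]
        ring
    have hRR : ∀ i, ∑ p, ∑ q, e.str (Sum.inl i) (Sum.inr p) (Sum.inr q) ^ 2 *
        (blockWeight x y (blockOf (𝔣 := 𝔣) (Sum.inr q)) / (blockWeight x y
          (blockOf (𝔣 := 𝔣) (Sum.inl i)) * blockWeight x y (blockOf (𝔣 := 𝔣) (Sum.inr p)))) = 0 :=
      fun i => Finset.sum_eq_zero fun p _ => Finset.sum_eq_zero fun q _ => by
        rw [e.str_swap, e.str_inr_eq_zero h𝔣 hC p (by simp)]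
        ring
    have hRL : ∑ i, ∑ p, ∑ k, e.str (Sum.inl i) (Sum.inr p) (Sum.inl k) ^ 2 *
        (blockWeight x y (blockOf (𝔣 := 𝔣) (Sum.inl k)) / (blockWeight x y
          (blockOf (𝔣 := 𝔣) (Sum.inl i)) * blockWeight x y (blockOf (𝔣 := 𝔣) (Sum.inr p)))) =
            ∑ p : Σ a : Fin m, Fin (Module.finrank ℝ (𝔣 a)), (1 - κ p.1) * (1 / y p.1) := by
      rw [Finset.sum_comm]
      refine Finset.sum_congr rfl fun p _ => ?_
      rw [← e.sum_str_inl_inl h𝔣 hC hκ p, Finset.sum_mul]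
      refine Finset.sum_congr rfl fun i _ => ?_
      rw [Finset.sum_mul]
      refine Finset.sum_congr rfl fun k _ => ?_
      have := hy0 p.1
      rw [e.str_swap, blockOf_inl, blockOf_inl, blockOf_inr, blockWeight_none, blockWeight_some]
      field_simp
    have hLR : ∑ i, ∑ j, ∑ p, e.str (Sum.inl i) (Sum.inl j) (Sum.inr p) ^ 2 *
        (blockWeight x y (blockOf (𝔣 := 𝔣) (Sum.inr p)) / (blockWeight x y
          (blockOf (𝔣 := 𝔣) (Sum.inl i)) * blockWeight x y (blockOf (𝔣 := 𝔣) (Sum.inl j)))) =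
            ∑ p : Σ a : Fin m, Fin (Module.finrank ℝ (𝔣 a)), (1 - κ p.1) * (y p.1 / x ^ 2) := by
      simp_rw [fun i => Finset.sum_comm (s := (Finset.univ : Finset (Fin _)))
        (t := (Finset.univ : Finset (Σ a : Fin m, Fin (Module.finrank ℝ (𝔣 a)))))
        (f := fun j p => e.str (Sum.inl i) (Sum.inl j) (Sum.inr p) ^ 2 *
        (blockWeight x y (blockOf (𝔣 := 𝔣) (Sum.inr p)) / (blockWeight x y
          (blockOf (𝔣 := 𝔣) (Sum.inl i)) * blockWeight x y (blockOf (𝔣 := 𝔣) (Sum.inl j)))))]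
      rw [Finset.sum_comm]
      refine Finset.sum_congr rfl fun p _ => ?_
      rw [← e.sum_str_inl_inl h𝔣 hC hκ p, Finset.sum_mul]
      refine Finset.sum_congr rfl fun i _ => ?_
      rw [Finset.sum_mul]
      refine Finset.sum_congr rfl fun k _ => ?_
      rw [e.str_swap', e.str_swap, blockOf_inl, blockOf_inl, blockOf_inr, blockWeight_none,
        blockWeight_some]
      ring
    simp only [Fintype.sum_sum_type, Finset.sum_add_distrib, hLL, hRR, hRL, hLR] at *
    simp only [mul_add, Finset.sum_add_distrib, Finset.sum_const_zero]
    ring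
  rw [Fintype.sum_sum_type, hP]
  simp_rw [hK]
  rw [Fintype.sum_sigma, Fintype.sum_sigma]
  simp only [Finset.sum_const, Finset.card_univ, Fintype.card_fin, nsmul_eq_mul,
    blockWeight_none, blockWeight_some]
  have hfin : ∀ a, (Module.finrank ℝ (𝔣 a) : ℝ) * (κ a / y a - (1 - κ a) * y a / x ^ 2) =
      -(Module.finrank ℝ (𝔣 a) * ((1 - κ a) * (1 / y a + y a / x ^ 2)))
        - Module.finrank ℝ (𝔣 a) * (1 / y a) - 2 * (Module.finrank ℝ (𝔣 a) * (-1 / y a)) :=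
    fun a => by ring
  simp_rw [hfin, Finset.sum_sub_distrib, Finset.sum_neg_distrib, ← Finset.mul_sum]
  have hn : (Module.finrank ℝ (complP 𝔨) : ℝ) * (1 / x) =
      2 * (Module.finrank ℝ (complP 𝔨) / (2 * x)) := by
    field_simp
  rw [hn]
  ring

end AdaptedBasis

/-! ### The set `M_K` -/

namespace AdaptedBasis

variable {L : Type*} [LieRing L] [LieAlgebra ℝ L] {𝔨 : LieSubalgebra ℝ L} {m : ℕ}
  {𝔣 : Fin m → LieIdeal ℝ 𝔨} (e : AdaptedBasis 𝔣) {x : ℝ} {y : Fin m → ℝ}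

theorem eq_of_killingForm_eq (e : AdaptedBasis 𝔣) {X Y : L} (h : ∀ Z, killingForm ℝ L X Z = killingForm ℝ L Y Z) :
    X = Y := by
  rw [← sub_eq_zero]
  have hd := e.isDiag_blockForm 1 fun _ => 1
  have hlin : (e.blockForm 1 fun _ => 1) (X - Y) = 0 := by
    refine e.basis.ext fun k => ?_
    rw [hd.apply_basis, map_sub, LinearMap.sub_apply, h, sub_self, mul_zero,
      LinearMap.zero_apply]
  exact (e.blockMetric one_pos fun _ => one_pos).eq_zero_of_form fun Z =>
    LinearMap.congr_fun hlin Z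

/-- The linear map `L → 𝔨` that vanishes on `𝔭` and is `-(y a / x) - 1` on `𝔣 a`. -/
def shift (x : ℝ) (y : Fin m → ℝ) : L →ₗ[ℝ] 𝔨 :=
  e.basis.constr ℝ (Sum.elim (fun _ => 0) fun p => (-(y p.1 / x) - 1) • (e.ideal p.1 p.2 : 𝔨))

/-- The section `X ↦ (X + E X, E X)` of the differential of the orbit map, where `E` is
`shift x y`. -/
def orbitSection (x : ℝ) (y : Fin m → ℝ) : L →ₗ[ℝ] L × 𝔨 :=
  LinearMap.prod (LinearMap.id + 𝔨.toSubmodule.subtype ∘ₗ e.shift x y) (e.shift x y)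

theorem orbitSection_apply (X : L) :
    e.orbitSection x y X = (X + (e.shift x y X : L), e.shift x y X) := rfl

theorem orbitMap_apply (u : L × 𝔨) : orbitMap 𝔨 u = u.1 - (u.2 : L) := rfl

theorem orbitMap_orbitSection (X : L) : orbitMap 𝔨 (e.orbitSection x y X) = X := by
  rw [orbitMap_apply, orbitSection_apply]
  simp

variable {e}

theorem IsDiag.eq_killingForm_shift {h : LinearMap.BilinForm ℝ L} (hh : e.IsDiag h x y)
    (hx : x ≠ 0) (X Y : L) :
    h X Y = x * killingForm ℝ L (X + (e.shift x y X : L)) Y := by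
  have heq : h = (x • killingForm ℝ L) ∘ₗ
      (LinearMap.id + 𝔨.toSubmodule.subtype ∘ₗ e.shift x y) :=
    LinearMap.BilinForm.ext_basis e.basis fun i j => by
      rw [hh i j]
      change _ = x * killingForm ℝ L (e.basis i + (e.shift x y (e.basis i) : L)) (e.basis j)
      rw [shift, Module.Basis.constr_basis]
      rcases i with i | p
      · simp [e.killing_eq]
      · rw [Sum.elim_inr, blockOf_inr, blockWeight_some]
        change _ = x * killingForm ℝ L (e.basis (Sum.inr p) + (-(y p.1 / x) - 1) •
          ((e.ideal p.1 p.2 : 𝔨) : L)) (e.basis j)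
        rw [← e.inr_eq, map_add, map_smul, LinearMap.add_apply, LinearMap.smul_apply,
          e.killing_eq, smul_eq_mul, blockOf_inr, blockSign_some]
        split_ifs
        · field_simp
          ring
        · ring
  exact LinearMap.congr_fun (LinearMap.congr_fun heq X) Y

theorem IsDiag.shift_lie {h : LinearMap.BilinForm ℝ L} (hh : e.IsDiag h x y) (hx : x ≠ 0)
    (h𝔣 : IsIdealDecomposition 𝔨 𝔣) (hC : IsCartanDecomposition 𝔨) (Z : 𝔨) (X : L) :
    e.shift x y ⁅(Z : L), X⁆ = ⁅Z, e.shift x y X⁆ := by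
  have heq : ⁅(Z : L), X⁆ + (e.shift x y ⁅(Z : L), X⁆ : L) =
      ⁅(Z : L), X⁆ + ⁅(Z : L), (e.shift x y X : L)⁆ := by
    refine e.eq_of_killingForm_eq fun Y => mul_left_cancel₀ hx ?_
    rw [← hh.eq_killingForm_shift hx, hh.inv h𝔣 hC Z.2, hh.eq_killingForm_shift hx, ← lie_add,
      killingForm_inv]
    ring
  exact Subtype.ext (add_left_cancel heq)

/-- The metrics `x Q|_𝔭 + ∑ a, y a Q|_(𝔣 a)` are naturally reductive with respect to `G × K`. -/
theorem IsDiag.mem_metricsMK (h𝔣 : IsIdealDecomposition 𝔨 𝔣) (hC : IsCartanDecomposition 𝔨)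
    {g : InvMetric L} (hg : e.IsDiag g.form x y) (hx : x ≠ 0) : g ∈ metricsMK 𝔨 := by
  have hinv := fun (Z : 𝔨) (X Y : L) => hg.inv h𝔣 hC Z.2 X Y
  -- The complement is chosen so that `g(X, Y) = x B(X + E X, Y)` with `E = shift x y` equivariant
  -- under `𝔨`.
  refine ⟨LinearMap.range (e.orbitSection x y), ⟨fun Z X Y => ?_, ?_, ?_, ?_⟩⟩
  · rw [hinv]
    ring
  · refine IsCompl.of_eq ?_ ?_
    · refine (Submodule.eq_bot_iff _).2 fun u hu => ?_
      obtain ⟨⟨Z, hZ⟩, ⟨X, hX⟩⟩ := Submodule.mem_inf.1 hu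
      have h0 : X = 0 := by
        rw [← e.orbitMap_orbitSection (x := x) (y := y) X, hX, ← hZ, orbitMap_apply]
        exact sub_self _
      rw [← hX, h0, map_zero]
    · refine eq_top_iff.2 fun u _ => ?_
      set X : L := u.1 - (u.2 : L) with hXdef
      refine Submodule.mem_sup.2 ⟨_, ⟨u.2 - e.shift x y X, rfl⟩, _, ⟨X, rfl⟩, ?_⟩
      rw [orbitSection_apply]
      refine Prod.ext ?_ ?_
      · change ((u.2 - e.shift x y X : 𝔨) : L) + (X + (e.shift x y X : L)) = u.1
        rw [AddSubgroupClass.coe_sub, hXdef]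
        abel
      · change (u.2 - e.shift x y X) + e.shift x y X = u.2
        abel
  · rintro Z _ ⟨X, rfl⟩
    refine ⟨⁅(Z : L), X⁆, ?_⟩
    rw [orbitSection_apply, orbitSection_apply, hg.shift_lie hx h𝔣 hC]
    refine Prod.ext ?_ rfl
    change ⁅(Z : L), X⁆ + ⁅(Z : L), (e.shift x y X : L)⁆ = ⁅(Z : L), X + (e.shift x y X : L)⁆
    rw [lie_add]
  · rintro _ ⟨X, rfl⟩ _ ⟨Y, rfl⟩ _ ⟨W, rfl⟩
    have hbr : ∀ Y, orbitMap 𝔨 ⁅e.orbitSection x y X, e.orbitSection x y Y⁆ =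
        ⁅X, Y + (e.shift x y Y : L)⁆ + ⁅(e.shift x y X : L), Y⁆ := fun Y => by
      rw [orbitMap_apply, orbitSection_apply, orbitSection_apply]
      change ⁅X + (e.shift x y X : L), Y + (e.shift x y Y : L)⁆ -
        ⁅(e.shift x y X : L), (e.shift x y Y : L)⁆ = _
      simp only [add_lie, lie_add]
      abel
    -- The terms with `⁅E X, ·⁆` cancel by `𝔨`-invariance of `g`; the others become `x B(⁅X, Y + E
    -- Y⁆, W + E W)` and its counterpart, which cancel by invariance of `B`.
    rw [hbr, hbr, e.orbitMap_orbitSection, e.orbitMap_orbitSection, map_add, map_add,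
      LinearMap.add_apply, hinv, hg.symm _ W, hg.eq_killingForm_shift hx W,
      hg.eq_killingForm_shift hx Y ⁅X, _⁆, killingForm_symm _ ⁅X, Y + _⁆, killingForm_inv]
    ring

variable [FiniteDimensional ℝ L]

/-- Every metric invariant under `𝔨` is of the form `x Q|_𝔭 + ∑ a, y a Q|_(𝔣 a)`. -/
theorem exists_isDiag [Nontrivial (Fin m)] (e : AdaptedBasis 𝔣) (h𝔣 : IsIdealDecomposition 𝔨 𝔣)
    (hC : IsCartanDecomposition 𝔨) (hL : LieAlgebra.IsSimple ℝ L) (g : InvMetric L)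
    (hg : ∀ (Z : 𝔨) (X Y : L), g.form ⁅(Z : L), X⁆ Y + g.form X ⁅(Z : L), Y⁆ = 0) :
    ∃ (x : ℝ) (y : Fin m → ℝ), 0 < x ∧ (∀ a, 0 < y a) ∧ e.IsDiag g.form x y := by
  have hinv : ∀ (Z : 𝔨) (X Y : L), g.form ⁅(Z : L), X⁆ Y = -g.form X ⁅(Z : L), Y⁆ :=
    fun Z X Y => eq_neg_of_add_eq_zero_left (hg Z X Y)
  obtain ⟨a₀, a₁, hne⟩ := exists_pair_ne (Fin m)
  have hp := hC.complP_ne_bot hL h𝔣 hne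
  obtain ⟨x, hx⟩ := hC.exists_form_eq_mul_of_mem_p hL g.form (fun X _ Y _ => g.symm X Y)
    fun Z hZ X _ Y _ => hinv ⟨Z, hZ⟩ X Y
  let gk : LinearMap.BilinForm ℝ 𝔨 := g.form.restrict 𝔨.toSubmodule
  choose y hy using fun a => h𝔣.exists_form_eq_mul hC hL hp a
    (gk.restrict (𝔣 a).toSubmodule) (fun X Y => g.symm _ _) fun X Y Z => hinv _ _ _
  have hpk : ∀ X ∈ complP 𝔨, ∀ a, ∀ Y ∈ 𝔣 a, g.form X (Y : L) = 0 := by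
    intro X hX a Y hY
    obtain ⟨b, hba⟩ := exists_ne a
    -- The part of `𝔭` that is `g`-orthogonal to `𝔣 a` is a submodule. It contains `[𝔣 b, 𝔭]`, since
    -- `𝔣 b` commutes with `𝔣 a`, and this is nonzero by faithfulness; irreducibility makes it all
    -- of `𝔭`. This is where a second ideal is needed.
    let V : Submodule ℝ L :=
      { carrier := {X | X ∈ complP 𝔨 ∧ ∀ Y ∈ 𝔣 a, g.form X (Y : L) = 0}
        add_mem' := fun {U W} hU hW => ⟨add_mem hU.1 hW.1, fun Y hY => by
          rw [map_add, LinearMap.add_apply, hU.2 Y hY, hW.2 Y hY, add_zero]⟩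
        zero_mem' := ⟨zero_mem _, fun Y _ => by simp⟩
        smul_mem' := fun c U hU => ⟨Submodule.smul_mem _ c hU.1, fun Y hY => by
          rw [map_smul, LinearMap.smul_apply, hU.2 Y hY, smul_zero]⟩ }
    have hV : V = complP 𝔨 := by
      refine hC.eq_complP_of_invariant hL V (fun U hU => hU.1) (fun Z hZ U hU =>
        ⟨lie_mem_complP hZ hU.1, fun Y hY => ?_⟩) fun h0 => ?_
      · have := hU.2 _ (lie_mem_right ℝ 𝔨 (𝔣 a) ⟨Z, hZ⟩ Y hY)
        rw [hinv ⟨Z, hZ⟩, neg_eq_zero]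
        exact this
      · obtain ⟨U, hU, hU0⟩ := (𝔣 b).toSubmodule.exists_mem_ne_zero_of_ne_bot
          (by simpa using h𝔣.ne_bot b)
        refine hU0 (Subtype.ext (hC.eq_zero_of_lie_eq_zero hL hp U.2 fun W hW => ?_))
        refine (Submodule.eq_bot_iff V).1 h0 _ ⟨lie_mem_complP U.2 hW, fun Y hY => ?_⟩
        have h1 : ⁅(U : L), (Y : L)⁆ = 0 := congrArg Subtype.val (h𝔣.lie_eq_zero hba hU hY)
        rw [hinv, h1, map_zero, neg_zero]
    have hm : X ∈ V := by
      rw [hV]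
      exact hX
    exact hm.2 Y hY
  -- The factors `y a` are relative to `B`, which is `-Q` on `𝔨`.
  have hdiag : e.IsDiag g.form x fun a => -y a := by
    rintro (i | p) (j | p')
    · rw [hx _ (e.mem_complP i) _ (e.mem_complP j), e.killing_eq]
      split_ifs <;> simp
    · rw [e.inr_eq, hpk _ (e.mem_complP i) _ _ (e.ideal p'.1 p'.2).2, if_neg (by simp)]
    · rw [g.symm, e.inr_eq, hpk _ (e.mem_complP j) _ _ (e.ideal p.1 p.2).2, if_neg (by simp)]
    · obtain ⟨a, i⟩ := p
      obtain ⟨a', i'⟩ := p'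
      rcases eq_or_ne a a' with rfl | haa
      · have h1 := hy a (e.ideal a i) (e.ideal a i')
        have h2 := e.killing_eq (Sum.inr ⟨a, i⟩) (Sum.inr ⟨a, i'⟩)
        rw [e.inr_eq, e.inr_eq] at h2 ⊢
        refine h1.trans ?_
        rw [h2]
        split_ifs <;> simp
      · rw [if_neg fun h => haa (congrArg Sigma.fst (Sum.inr_injective h)), e.inr_eq, e.inr_eq]
        exact h𝔣.form_eq_zero haa gk (fun X Y => g.symm _ _) (fun X Y Z => hinv _ _ _)
          (e.ideal a i).2 (e.ideal a' i').2
  refine ⟨x, fun a => -y a, ?_, fun a => ?_, hdiag⟩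
  · obtain ⟨X, hX, hX0⟩ := (complP 𝔨).exists_mem_ne_zero_of_ne_bot hp
    have h1 := hx X hX X hX
    have h2 := g.pos X hX0
    rw [h1] at h2
    exact pos_of_mul_pos_left h2 (hC.pos_on_p X hX hX0).le
  · have := h𝔣.nontrivial a
    let i : BlockIndex 𝔣 := Sum.inr ⟨a, ⟨0, Module.finrank_pos⟩⟩
    have h1 := hdiag i i
    rw [if_pos rfl] at h1
    have h2 := g.pos _ (e.basis.ne_zero i)
    rw [h1] at h2
    exact h2

theorem mem_metricsMK_iff [Nontrivial (Fin m)] (e : AdaptedBasis 𝔣)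
    (h𝔣 : IsIdealDecomposition 𝔨 𝔣) (hC : IsCartanDecomposition 𝔨)
    (hL : LieAlgebra.IsSimple ℝ L) (g : InvMetric L) : g ∈ metricsMK 𝔨 ↔
      ∃ (x : ℝ) (y : Fin m → ℝ), 0 < x ∧ (∀ a, 0 < y a) ∧ e.IsDiag g.form x y :=
  ⟨fun ⟨_, h⟩ => e.exists_isDiag h𝔣 hC hL g h.isometric,
    fun ⟨_, _, hx, _, h⟩ => h.mem_metricsMK h𝔣 hC hx.ne'⟩

end AdaptedBasis

/-! ### Cubic polynomials with a double root -/

section Cubic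

variable {a b c d : ℝ}

/-- The third root comes from Vieta's formula for the sum of the roots; the two hypotheses then give
the remaining coefficients. -/
theorem cubic_eq_of_double_root (ha : a ≠ 0) {s : ℝ} (h0 : a * s ^ 3 + b * s ^ 2 + c * s + d = 0)
    (h1 : 3 * a * s ^ 2 + 2 * b * s + c = 0) :
    ∃ r : ℝ, b = -a * (2 * s + r) ∧ c = a * (s ^ 2 + 2 * s * r) ∧ d = -a * s ^ 2 * r := by
  refine ⟨-b / a - 2 * s, ?_, ?_, ?_⟩
  · field_simp
    ring
  · field_simp
    linear_combination h1
  · field_simp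
    linear_combination h0 - s * h1

theorem discrD_of_double_root {s r : ℝ} (hb : b = -a * (2 * s + r))
    (hc : c = a * (s ^ 2 + 2 * s * r)) (hd : d = -a * s ^ 2 * r) : discrD a b c d = 0 := by
  subst hb hc hd
  unfold discrD
  ring

theorem sq_sub_of_double_root {s r : ℝ} (hb : b = -a * (2 * s + r))
    (hc : c = a * (s ^ 2 + 2 * s * r)) : b ^ 2 - 3 * a * c = a ^ 2 * (s - r) ^ 2 := by
  subst hb hc
  ring

theorem rootRd_of_double_root (ha : a ≠ 0) {s r : ℝ} (hsr : s ≠ r) (hb : b = -a * (2 * s + r))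
    (hc : c = a * (s ^ 2 + 2 * s * r)) (hd : d = -a * s ^ 2 * r) : rootRd a b c d = s := by
  have hne := sub_ne_zero.2 hsr
  rw [rootRd, sq_sub_of_double_root hb hc, div_eq_iff (by positivity)]
  subst hb hc hd
  ring

theorem rootRs_of_double_root (ha : a ≠ 0) {s r : ℝ} (hsr : s ≠ r) (hb : b = -a * (2 * s + r))
    (hc : c = a * (s ^ 2 + 2 * s * r)) (hd : d = -a * s ^ 2 * r) : rootRs a b c d = r := by
  have hne := sub_ne_zero.2 hsr
  rw [rootRs, sq_sub_of_double_root hb hc, div_eq_iff (by positivity)]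
  subst hb hc hd
  ring

/-- After clearing denominators, the value of the cubic at `R_d` is a polynomial multiple of the
discriminant; likewise for the derivative in `cubic_deriv_rootRd`. So `R_d` is the double root. -/
theorem cubic_rootRd (hD : discrD a b c d = 0) (h : b ^ 2 ≠ 3 * a * c) :
    a * rootRd a b c d ^ 3 + b * rootRd a b c d ^ 2 + c * rootRd a b c d + d = 0 := by
  have hne : b ^ 2 - 3 * a * c ≠ 0 := sub_ne_zero.2 h
  unfold discrD at hD
  rw [rootRd]
  generalize he : b ^ 2 - 3 * a * c = Δ at *
  field_simp
  subst he
  linear_combination -(27 * a ^ 2 * d - 9 * a * b * c + 2 * b ^ 3) * hD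

theorem cubic_deriv_rootRd (hD : discrD a b c d = 0) (h : b ^ 2 ≠ 3 * a * c) :
    3 * a * rootRd a b c d ^ 2 + 2 * b * rootRd a b c d + c = 0 := by
  have hne : b ^ 2 - 3 * a * c ≠ 0 := sub_ne_zero.2 h
  unfold discrD at hD
  rw [rootRd]
  generalize he : b ^ 2 - 3 * a * c = Δ at *
  field_simp
  subst he
  linear_combination -9 * a * hD

/-- A cubic polynomial with a triple root and positive leading coefficient is negative to the left
of the root. -/
theorem cubic_nonpos_of_lt_rootRt (ha : 0 < a) (hD : discrD a b c d = 0) (h : b ^ 2 = 3 * a * c)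
    {w : ℝ} (hw : w < rootRt a b) : a * w ^ 3 + b * w ^ 2 + c * w + d ≤ 0 := by
  -- The square equals `4 (b² - 3ac)³ - 27 a² D`. With both invariants zero the cubic is a perfect
  -- cube up to a constant: `27 a² P(w) = (3 a w + b)³`.
  have h1 : (27 * a ^ 2 * d - 9 * a * b * c + 2 * b ^ 3) ^ 2 = 0 := by
    unfold discrD at hD
    linear_combination -27 * a ^ 2 * hD + 4 * (b ^ 2 - 3 * a * c) ^ 2 * h
  have h2 := pow_eq_zero_iff two_ne_zero |>.1 h1
  rw [rootRt, lt_div_iff₀ (by positivity)] at hw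
  have h3 : 27 * a ^ 2 * (a * w ^ 3 + b * w ^ 2 + c * w + d) = (3 * a * w + b) ^ 3 := by
    linear_combination h2 - 3 * (3 * a * w + b) * h
  have h4 : (3 * a * w + b) ^ 3 < 0 := Odd.pow_neg (by decide) (by linarith)
  by_contra! hpos
  have : 0 < 27 * a ^ 2 * (a * w ^ 3 + b * w ^ 2 + c * w + d) := by positivity
  linarith

end Cubic

/-! ### The scalar curvature as a function of two parameters -/

/-- The numerical data of a decomposition of `L` into three blocks and of the form `T`. -/
structure BlockData where
  (n d₁ d₂ κ₁ κ₂ Tp T₁ T₂ : ℝ)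
  n_pos : 0 < n
  d₁_pos : 0 < d₁
  d₂_pos : 0 < d₂
  κ₁_lt : κ₁ < 1
  κ₂_lt : κ₂ < 1
  Tp_pos : 0 < Tp
  T₁_pos : 0 < T₁
  T₂_pos : 0 < T₂

namespace BlockData

variable (B : BlockData)

/-- The coefficient of `x ^ 3`. -/
def a : ℝ := B.n * B.d₂ * (1 - B.κ₂) * B.Tp

/-- The coefficient of `x ^ 2`. -/
def b : ℝ := B.d₁ ^ 2 * (1 - B.κ₁) * B.T₁ - B.d₂ ^ 2 * (1 - B.κ₂) * B.T₂ + 2 * B.n ^ 2 * B.Tp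
  - B.n ^ 2 * B.κ₁ * B.Tp ^ 2 / B.T₁

/-- The coefficient of `x`. -/
def c : ℝ := -2 * B.n * B.d₂ * B.T₂ + 2 * B.n * B.d₂ * B.κ₁ * B.Tp * B.T₂ / B.T₁
  - B.n * B.d₂ * B.κ₂ * B.Tp

/-- The constant coefficient. -/
def d : ℝ := -(B.d₂ ^ 2 * B.κ₁ * B.T₂ ^ 2 / B.T₁) + B.κ₂ * B.d₂ ^ 2 * B.T₂

/-- The cubic polynomial. -/
def P (s : ℝ) : ℝ := B.a * s ^ 3 + B.b * s ^ 2 + B.c * s + B.d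

/-- The derivative of the cubic polynomial. -/
def dP (s : ℝ) : ℝ := 3 * B.a * s ^ 2 + 2 * B.b * s + B.c

/-- The infimum of the quotients `y₂ / x` of the parameters of the metrics with `tr_g T = 0`. -/
def w : ℝ := B.d₂ * B.T₂ / (B.n * B.Tp)

/-- The scale invariant part of the scalar curvature. -/
def G (β : ℝ) : ℝ :=
  -(4 * (B.w + Real.exp β) * (B.n * B.Tp * Real.exp β))⁻¹ * B.P (B.w + Real.exp β)

/-- The parameters of the metrics on the ideals. -/
def y (α β : ℝ) : Fin 2 → ℝ :=
  ![Real.exp α * (B.d₁ * B.T₁ / (B.n * B.Tp)) * (B.w * Real.exp (-β) + 1),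
    Real.exp α * (B.w + Real.exp β)]

theorem a_pos : 0 < B.a := by
  have := B.n_pos
  have := B.d₂_pos
  have := B.Tp_pos
  have := sub_pos.2 B.κ₂_lt
  unfold a
  positivity

theorem w_pos : 0 < B.w := by
  have := B.n_pos
  have := B.d₂_pos
  have := B.Tp_pos
  have := B.T₂_pos
  unfold w
  positivity

theorem y_pos (α β : ℝ) (i : Fin 2) : 0 < B.y α β i := by
  have := B.w_pos
  have := B.n_pos
  have := B.d₁_pos
  have := B.Tp_pos
  have := B.T₁_pos
  fin_cases i
  · change 0 < Real.exp α * (B.d₁ * B.T₁ / (B.n * B.Tp)) * (B.w * Real.exp (-β) + 1)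
    positivity
  · change 0 < Real.exp α * (B.w + Real.exp β)
    positivity

/-- At `w` all contributions cancel except `d₁² (1 - κ₁) T₁ w²`. It reflects the boundary `s → w`,
where `y₁ / x → ∞` and the term of the scalar curvature with `-(1 - κ₁) y₁ / x²` dominates. -/
theorem P_w_pos : 0 < B.P B.w := by
  have hn := B.n_pos
  have hTp := B.Tp_pos
  have hT₁ := B.T₁_pos
  have h : B.P B.w = B.d₁ ^ 2 * (1 - B.κ₁) * B.T₁ * B.w ^ 2 := by
    unfold P a b c d w
    field_simp
    ring
  have := B.w_pos
  have := B.d₁_pos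
  have := sub_pos.2 B.κ₁_lt
  rw [h]
  positivity

/-- Solving the constraint for `y₁` with `y₂ = x s` gives `y₁ = x (d₁ T₁ / (n T_𝔭)) s / (s - w)`;
this is the first entry of `y`. -/
theorem tr_param (α β : ℝ) : B.n * (-B.Tp / Real.exp α) +
    (B.d₁ * (B.T₁ / B.y α β 0) + B.d₂ * (B.T₂ / B.y α β 1)) = 0 := by
  have hw := B.w_pos
  have hn := B.n_pos
  have hd₁ := B.d₁_pos
  have hTp := B.Tp_pos
  have hT₁ := B.T₁_pos
  have hα := Real.exp_pos α
  have hβ := Real.exp_pos β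
  have hw' : B.w * (B.n * B.Tp) = B.d₂ * B.T₂ := div_mul_cancel₀ _ (by positivity)
  simp only [y, Matrix.cons_val_zero, Matrix.cons_val_one, Real.exp_neg]
  generalize Real.exp α = A at *
  generalize Real.exp β = E at *
  generalize B.w = w at *
  have : w * E⁻¹ + 1 = (w + E) / E := by field_simp
  rw [this]
  field_simp
  linear_combination -hw'

/-- The coefficients of `P` are those of the numerator obtained by putting the scalar curvature over
the common denominator `4 n T_𝔭 s (s - w)`. -/
theorem scal_param (α β : ℝ) : -(B.n / (2 * Real.exp α)) + 1 / 4 *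
    (B.d₁ * (B.κ₁ / B.y α β 0 - (1 - B.κ₁) * B.y α β 0 / Real.exp α ^ 2) +
      B.d₂ * (B.κ₂ / B.y α β 1 - (1 - B.κ₂) * B.y α β 1 / Real.exp α ^ 2)) =
        Real.exp (-α) * B.G β := by
  have hw := B.w_pos
  have hn := B.n_pos
  have hd₁ := B.d₁_pos
  have hd₂ := B.d₂_pos
  have hTp := B.Tp_pos
  have hT₁ := B.T₁_pos
  have hT₂ := B.T₂_pos
  have hα := Real.exp_pos α
  have hβ := Real.exp_pos β
  have hw' : B.T₂ = B.w * (B.n * B.Tp) / B.d₂ := by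
    rw [w]
    field_simp
  simp only [y, G, P, a, b, c, d, Matrix.cons_val_zero, Matrix.cons_val_one, Real.exp_neg]
  rw [hw']
  generalize Real.exp α = A at *
  generalize Real.exp β = E at *
  generalize B.w = w at *
  have : w * E⁻¹ + 1 = (w + E) / E := by field_simp
  rw [this]
  field_simp
  ring

/-- The parametrization exhausts the metrics with `tr_g T = 0`. -/
theorem exists_param {x : ℝ} {z : Fin 2 → ℝ} (hx : 0 < x) (hz : ∀ i, 0 < z i)
    (h : B.n * (-B.Tp / x) + (B.d₁ * (B.T₁ / z 0) + B.d₂ * (B.T₂ / z 1)) = 0) :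
    ∃ α β, x = Real.exp α ∧ z = B.y α β := by
  have hn := B.n_pos
  have hd₁ := B.d₁_pos
  have hTp := B.Tp_pos
  have hT₁ := B.T₁_pos
  have h0 := hz 0
  have h1 := hz 1
  have hw' : B.w * (B.n * B.Tp) = B.d₂ * B.T₂ := div_mul_cancel₀ _ (by positivity)
  -- The trace condition itself forces `y₂ / x > w`, so that `β` can be taken as a logarithm.
  have hlt : z 1 / x - B.w = B.d₁ * B.T₁ * z 1 / (B.n * B.Tp * z 0) := by
    field_simp at h ⊢
    linear_combination -h - x * z 0 * hw'
  have hpos : 0 < z 1 / x - B.w := by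
    rw [hlt]
    positivity
  refine ⟨Real.log x, Real.log (z 1 / x - B.w), (Real.exp_log hx).symm, ?_⟩
  ext i
  fin_cases i
  · simp only [y, Fin.zero_eta, Matrix.cons_val_zero, Real.exp_neg, Real.exp_log hx,
      Real.exp_log hpos]
    have hE : B.w = z 1 / x - B.d₁ * B.T₁ * z 1 / (B.n * B.Tp * z 0) := by linarith
    rw [hlt]
    generalize B.w = w at *
    rw [hE]
    field_simp
    ring
  · change z 1 = Real.exp (Real.log x) * (B.w + Real.exp (Real.log (z 1 / x - B.w)))
    rw [Real.exp_log hx, Real.exp_log hpos]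
    field_simp
    ring

theorem hasDerivAt_P (s : ℝ) : HasDerivAt B.P (B.dP s) s := by
  have h := (((hasDerivAt_pow 3 s).const_mul B.a).add ((hasDerivAt_pow 2 s).const_mul B.b)).add
    (((hasDerivAt_id s).const_mul B.c).add_const B.d)
  refine (h.congr_deriv ?_).congr_of_eventuallyEq (Eventually.of_forall fun t => ?_)
  · simp [dP]
    ring
  · simp [P]
    ring

theorem G_factor_pos (β : ℝ) :
    0 < (4 * (B.w + Real.exp β) * (B.n * B.Tp * Real.exp β))⁻¹ := by
  have := B.w_pos
  have := B.n_pos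
  have := B.Tp_pos
  positivity

theorem P_eq_zero_of_G {β : ℝ} (h : B.G β = 0) : B.P (B.w + Real.exp β) = 0 :=
  (mul_eq_zero.1 h).resolve_left (neg_ne_zero.2 (B.G_factor_pos β).ne')

theorem differentiable_G : Differentiable ℝ B.G := by
  have h1 : Differentiable ℝ B.P := fun s => (B.hasDerivAt_P s).differentiableAt
  have h2 : Differentiable ℝ fun β => (4 * (B.w + Real.exp β) * (B.n * B.Tp * Real.exp β))⁻¹ := by
    refine Differentiable.inv (by fun_prop) fun β => ?_
    exact (inv_pos.1 (B.G_factor_pos β)).ne'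
  exact h2.neg.mul (h1.comp (by fun_prop))

theorem deriv_P_eq_zero_of_G {β : ℝ} (h : B.G β = 0) (h' : HasDerivAt B.G 0 β) :
    B.dP (B.w + Real.exp β) = 0 := by
  have hP := B.P_eq_zero_of_G h
  have h2 : DifferentiableAt ℝ
      (fun β => -(4 * (B.w + Real.exp β) * (B.n * B.Tp * Real.exp β))⁻¹) β := by
    refine (DifferentiableAt.inv (by fun_prop) ?_).neg
    exact (inv_pos.1 (B.G_factor_pos β)).ne'
  have h3 : HasDerivAt (fun β => B.P (B.w + Real.exp β))
      (B.dP (B.w + Real.exp β) * Real.exp β) β :=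
    (B.hasDerivAt_P _).comp β ((Real.hasDerivAt_exp β).const_add B.w)
  have h4 := (h2.hasDerivAt.mul h3).unique h'
  rw [hP, mul_zero, zero_add] at h4
  have h5 := (mul_eq_zero.1 h4).resolve_left (neg_ne_zero.2 (B.G_factor_pos β).ne')
  exact (mul_eq_zero.1 h5).resolve_right (Real.exp_ne_zero β)

/-- The number `w + exp β` is a double root of the cubic polynomial. -/
def IsDouble (β : ℝ) : Prop := B.P (B.w + Real.exp β) = 0 ∧ B.dP (B.w + Real.exp β) = 0

/-! ### Consequences of a double root beyond `w` -/

variable {B}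

/-- In `P(s) = a (s - s₀)² (s - r)` the first two factors are nonnegative at `w`, so `P(w) > 0`
forces `r < w`. -/
theorem IsDouble.exists_root {β : ℝ} (h : B.IsDouble β) : ∃ r < B.w,
    B.b = -B.a * (2 * (B.w + Real.exp β) + r) ∧
    B.c = B.a * ((B.w + Real.exp β) ^ 2 + 2 * (B.w + Real.exp β) * r) ∧
    B.d = -B.a * (B.w + Real.exp β) ^ 2 * r ∧
    ∀ s, B.P s = B.a * (s - (B.w + Real.exp β)) ^ 2 * (s - r) := by
  obtain ⟨r, hb, hc, hd⟩ := cubic_eq_of_double_root B.a_pos.ne' h.1 h.2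
  have hP : ∀ s, B.P s = B.a * (s - (B.w + Real.exp β)) ^ 2 * (s - r) := fun s => by
    rw [P, hb, hc, hd]
    ring
  refine ⟨r, ?_, hb, hc, hd, hP⟩
  have h0 := B.P_w_pos
  rw [hP] at h0
  have ha := B.a_pos
  exact sub_pos.1 (pos_of_mul_pos_right h0 (by positivity))

theorem IsDouble.G_nonpos {β : ℝ} (h : B.IsDouble β) (β' : ℝ) : B.G β' ≤ 0 := by
  obtain ⟨r, hr, -, -, -, hP⟩ := h.exists_root
  have h1 := B.G_factor_pos β'
  have h2 : 0 ≤ B.P (B.w + Real.exp β') := by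
    have ha := B.a_pos
    have := Real.exp_pos β'
    have : 0 ≤ B.w + Real.exp β' - r := by linarith
    rw [hP]
    positivity
  rw [G, neg_mul]
  exact neg_nonpos.2 (mul_nonneg h1.le h2)

theorem IsDouble.G_self {β : ℝ} (h : B.IsDouble β) : B.G β = 0 := by
  rw [G, h.1, mul_zero]

theorem IsDouble.eq_of_G_eq_zero {β β' : ℝ} (h : B.IsDouble β) (h' : B.G β' = 0) : β' = β := by
  obtain ⟨r, hr, -, -, -, hP⟩ := h.exists_root
  have h0 := B.P_eq_zero_of_G h'
  rw [hP] at h0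
  have h1 : B.w + Real.exp β' - r ≠ 0 := by
    have := Real.exp_pos β'
    linarith
  have h2 := (mul_eq_zero.1 ((mul_eq_zero.1 h0).resolve_right h1)).resolve_left B.a_pos.ne'
  have h3 := pow_eq_zero_iff two_ne_zero |>.1 h2
  exact Real.exp_injective (by linarith)

/-- The roots satisfy `r < w < s₀`, so the double root is not triple, and `R_d = s₀`, `R_s = r`. -/
theorem IsDouble.roots {β : ℝ} (h : B.IsDouble β) : discrD B.a B.b B.c B.d = 0 ∧
    B.b ^ 2 ≠ 3 * B.a * B.c ∧ rootRs B.a B.b B.c B.d ≤ B.w ∧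
      B.w < rootRd B.a B.b B.c B.d := by
  obtain ⟨r, hr, hb, hc, hd, -⟩ := h.exists_root
  have he := Real.exp_pos β
  have hne : B.w + Real.exp β ≠ r := by linarith
  have ha := B.a_pos.ne'
  refine ⟨discrD_of_double_root hb hc hd, fun h0 => ?_, ?_, ?_⟩
  · have h1 := sq_sub_of_double_root hb hc
    rw [h0, sub_self] at h1
    have := sub_ne_zero.2 hne
    have : B.a ^ 2 * (B.w + Real.exp β - r) ^ 2 ≠ 0 := by positivity
    exact this h1.symm
  · rw [rootRs_of_double_root ha hne hb hc hd]
    exact hr.le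
  · rw [rootRd_of_double_root ha hne hb hc hd]
    linarith

variable (B)

theorem isDouble_log_rootRd (hD : discrD B.a B.b B.c B.d = 0) (h : B.b ^ 2 ≠ 3 * B.a * B.c)
    (hw : B.w < rootRd B.a B.b B.c B.d) :
    B.IsDouble (Real.log (rootRd B.a B.b B.c B.d - B.w)) := by
  unfold IsDouble P dP
  rw [Real.exp_log (sub_pos.2 hw), add_sub_cancel]
  exact ⟨cubic_rootRd hD h, cubic_deriv_rootRd hD h⟩

/-- The argument of `IsDouble.exists_root` with no assumption on the position of the double root.
This is what excludes the numerical conditions for proper local maxima and for local minima. -/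
theorem rootRs_lt (hD : discrD B.a B.b B.c B.d = 0) (h : B.b ^ 2 ≠ 3 * B.a * B.c) :
    rootRs B.a B.b B.c B.d < B.w := by
  have ha := B.a_pos
  obtain ⟨r, hb, hc, hd⟩ := cubic_eq_of_double_root ha.ne' (cubic_rootRd hD h)
    (cubic_deriv_rootRd hD h)
  set s := rootRd B.a B.b B.c B.d
  have hsr : s ≠ r := by
    intro hsr
    have h1 := sq_sub_of_double_root hb hc
    rw [hsr, sub_self, zero_pow two_ne_zero, mul_zero] at h1
    exact h (sub_eq_zero.1 h1)
  rw [rootRs_of_double_root ha.ne' hsr hb hc hd]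
  have h0 := B.P_w_pos
  have hP : B.P B.w = B.a * (B.w - s) ^ 2 * (B.w - r) := by
    rw [P, hb, hc, hd]
    ring
  rw [hP] at h0
  exact sub_pos.1 (pos_of_mul_pos_right h0 (by positivity))

theorem exists_G_neg : ∃ β, B.G β < 0 := by
  have h1 : ∀ᶠ s in 𝓝[>] B.w, 0 < B.P s :=
    ((B.hasDerivAt_P B.w).continuousAt.eventually (lt_mem_nhds B.P_w_pos)).filter_mono
      nhdsWithin_le_nhds
  obtain ⟨s, hs, hsw⟩ := (h1.and self_mem_nhdsWithin).exists
  refine ⟨Real.log (s - B.w), ?_⟩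
  have h2 := B.G_factor_pos (Real.log (s - B.w))
  rw [G, neg_mul, neg_lt_zero]
  refine mul_pos h2 ?_
  rwa [Real.exp_log (sub_pos.2 hsw), add_sub_cancel]

end BlockData

/-! ### Critical points of the scalar curvature functional -/

section Critical

variable {L : Type*} [LieRing L] [LieAlgebra ℝ L]

/-- `φ` parametrizes the set of metrics `M` by two real numbers, the first of which is the logarithm
of a scaling factor, in such a way that `S` is given by the function `G`. -/
structure IsParam (B : BlockData) (S : InvMetric L → ℝ) (M : Set (InvMetric L))
    (φ : ℝ → ℝ → InvMetric L) : Prop where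
  mem : ∀ α β, φ α β ∈ M
  exists_eq : ∀ g ∈ M, ∃ α β, g = φ α β
  value : ∀ α β, S (φ α β) = Real.exp (-α) * B.G β
  continuous : ∀ f g : ℝ → ℝ, Continuous f → Continuous g → Continuous fun t => φ (f t) (g t)
  contDiff : ∀ f g : ℝ → ℝ, ContDiff ℝ ∞ f → ContDiff ℝ ∞ g →
    ∀ X Y, ContDiff ℝ ∞ fun t => (φ (f t) (g t)).form X Y
  form_eq : ∀ α α' β X Y, (φ α' β).form X Y = Real.exp (α' - α) * (φ α β).form X Y

namespace IsParam

variable {B : BlockData} {S : InvMetric L → ℝ} {M : Set (InvMetric L)}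
  {φ : ℝ → ℝ → InvMetric L}

/-- The derivative of `exp (-α) G(β)` in the scale is `-exp (-α) G(β)`, so `G` vanishes; where `G`
vanishes, its derivative is a nonzero multiple of that of `P`. -/
theorem isDouble_of_hasDerivAt (h : IsParam B S M φ) {α β : ℝ}
    (h1 : HasDerivAt (fun t => S (φ (α + t) β)) 0 0)
    (h2 : HasDerivAt (fun t => S (φ α (β + t))) 0 0) : B.IsDouble β := by
  simp only [h.value] at h1 h2
  have hG : B.G β = 0 := by
    have hd : HasDerivAt (fun t : ℝ => Real.exp (-(α + t)) * B.G β)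
        (Real.exp (-(α + 0)) * -1 * B.G β) 0 :=
      ((((hasDerivAt_id (0 : ℝ)).const_add α).neg).exp).mul_const _
    have h0 := hd.unique h1
    have he := Real.exp_pos (-(α + 0))
    exact (mul_eq_zero.1 h0).resolve_left (by linarith)
  refine ⟨B.P_eq_zero_of_G hG, B.deriv_P_eq_zero_of_G hG ?_⟩
  have hd : HasDerivAt (fun t => B.G (β + t)) (deriv B.G β) 0 := by
    have h3 : HasDerivAt B.G (deriv B.G β) (β + 0) := by
      rw [add_zero]
      exact (B.differentiable_G β).hasDerivAt
    exact h3.comp_const_add β 0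
  have h0 := (hd.const_mul (Real.exp (-α))).unique h2
  rw [← (mul_eq_zero.1 h0).resolve_left (Real.exp_pos _).ne']
  exact (B.differentiable_G β).hasDerivAt

theorem isDouble_of_isCriticalPointOn (h : IsParam B S M φ) {α β : ℝ}
    (hc : IsCriticalPointOn S M (φ α β)) : B.IsDouble β :=
  h.isDouble_of_hasDerivAt
    (hc.2 (fun t => φ (α + t) β) (by simp)
      (fun X Y => (h.contDiff _ _ (by fun_prop) contDiff_const X Y).contDiffAt)
      (Eventually.of_forall fun t => h.mem _ _))
    (hc.2 (fun t => φ α (β + t)) (by simp)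
      (fun X Y => (h.contDiff _ _ contDiff_const (by fun_prop) X Y).contDiffAt)
      (Eventually.of_forall fun t => h.mem _ _))

theorem tendsto (h : IsParam B S M φ) {α β : ℝ} {f g : ℝ → ℝ} (hf : Continuous f)
    (hg : Continuous g) (hf0 : f 0 = α) (hg0 : g 0 = β) :
    Tendsto (fun t => φ (f t) (g t)) (𝓝 0) (𝓝[M] (φ α β)) := by
  refine tendsto_nhdsWithin_iff.2 ⟨?_, Eventually.of_forall fun t => h.mem _ _⟩
  have := (h.continuous f g hf hg).tendsto 0
  rwa [hf0, hg0] at this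

/-- Along each coordinate line the extremum becomes one of a differentiable function of one
variable, so no smooth structure on `M` is needed. -/
theorem isDouble_of_isLocalExtrOn (h : IsParam B S M φ) {α β : ℝ}
    (hc : IsLocalExtrOn S M (φ α β)) : B.IsDouble β := by
  have key : ∀ f g : ℝ → ℝ, Continuous f → Continuous g → f 0 = α → g 0 = β →
      DifferentiableAt ℝ (fun t => S (φ (f t) (g t))) 0 →
      HasDerivAt (fun t => S (φ (f t) (g t))) 0 0 := by
    intro f g hf hg hf0 hg0 hd
    have hext : IsLocalExtr (fun t => S (φ (f t) (g t))) 0 := by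
      have hc' : IsLocalExtrOn S M (φ (f 0) (g 0)) := by
        rw [hf0, hg0]
        exact hc
      exact IsExtrFilter.comp_tendsto (g := fun t => φ (f t) (g t)) hc'
        (h.tendsto hf hg rfl rfl)
    have := hd.hasDerivAt
    rwa [hext.deriv_eq_zero] at this
  refine h.isDouble_of_hasDerivAt (key _ (fun _ => β) (by fun_prop) continuous_const (by simp) rfl ?_)
    (key (fun _ => α) _ continuous_const (by fun_prop) rfl (by simp) ?_)
  · simp only [h.value]
    fun_prop
  · simp only [h.value]
    have := (B.differentiable_G (β + 0)).comp (0 : ℝ) (f := fun t => β + t) (by fun_prop)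
    exact this.const_mul _

theorem isMaxOn (h : IsParam B S M φ) {α β : ℝ} (hd : B.IsDouble β) : IsMaxOn S M (φ α β) := by
  intro g hg
  obtain ⟨α', β', rfl⟩ := h.exists_eq g hg
  change S (φ α' β') ≤ S (φ α β)
  rw [h.value, h.value, hd.G_self, mul_zero]
  exact mul_nonpos_of_nonneg_of_nonpos (Real.exp_pos _).le (hd.G_nonpos β')

/-- A local minimum would lie at a double root, where `S` vanishes; but moving `β` slightly makes
`S` strictly negative. -/
theorem not_isLocalMinOn (h : IsParam B S M φ) {α β : ℝ} : ¬ IsLocalMinOn S M (φ α β) := by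
  intro hmin
  have hd := h.isDouble_of_isLocalExtrOn (Or.inl hmin)
  have ht : Tendsto (fun t => φ α (β + t)) (𝓝[≠] 0) (𝓝[M] (φ α β)) :=
    (h.tendsto (f := fun _ => α) continuous_const (by fun_prop) rfl (by simp)).mono_left
      nhdsWithin_le_nhds
  obtain ⟨t, ht, ht0⟩ := ((ht.eventually hmin).and self_mem_nhdsWithin).exists
  rw [h.value, h.value, hd.G_self, mul_zero] at ht
  have h1 := nonneg_of_mul_nonneg_right ht (Real.exp_pos _)
  have h2 := hd.eq_of_G_eq_zero (le_antisymm (hd.G_nonpos _) h1)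
  exact ht0 (by simpa using h2)

theorem not_isMinOn (h : IsParam B S M φ) (g : InvMetric L) : ¬ IsMinOn S M g := by
  intro hmin
  obtain ⟨β, hβ⟩ := B.exists_G_neg
  -- Scaling by `exp (-t)` beats `S g`: since `exp t ≥ t + 1` and `G β < 0`, the new value is at
  -- most `S g + G β`.
  set t := |S g / B.G β|
  have h1 : S g ≤ S (φ (-t) β) := hmin (h.mem _ _)
  rw [h.value, neg_neg] at h1
  have h2 : Real.exp t * B.G β ≤ (t + 1) * B.G β :=
    mul_le_mul_of_nonpos_right (Real.add_one_le_exp t) hβ.le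
  have h3 : t * B.G β ≤ S g / B.G β * B.G β :=
    mul_le_mul_of_nonpos_right (le_abs_self _) hβ.le
  rw [div_mul_cancel₀ _ hβ.ne] at h3
  linarith

/-- A critical point is a global maximum, so no larger values occur. -/
theorem not_isSaddlePointOn (h : IsParam B S M φ) {α β : ℝ} :
    ¬ IsSaddlePointOn S M (φ α β) := by
  intro hs
  obtain ⟨g, hg, hgM⟩ := (hs.2.2.and_eventually self_mem_nhdsWithin).exists
  have := h.isMaxOn (α := α) (h.isDouble_of_isCriticalPointOn hs.1) hgM
  exact absurd hg (not_lt.2 this)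

theorem exists_smul_of_isCriticalPointOn (h : IsParam B S M φ) {g g' : InvMetric L}
    (hg : IsCriticalPointOn S M g) (hg' : IsCriticalPointOn S M g') :
    ∃ s : ℝ, 0 < s ∧ ∀ X Y, g'.form X Y = s * g.form X Y := by
  obtain ⟨α, β, rfl⟩ := h.exists_eq g hg.1
  obtain ⟨α', β', rfl⟩ := h.exists_eq g' hg'.1
  have hd := h.isDouble_of_isCriticalPointOn hg
  have hd' := h.isDouble_of_isCriticalPointOn hg'
  obtain rfl := hd.eq_of_G_eq_zero hd'.G_self
  exact ⟨_, Real.exp_pos (α' - α), h.form_eq α α' β'⟩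

theorem exists_isMaxOn_iff (h : IsParam B S M φ) : (∃ g ∈ M, IsMaxOn S M g) ↔
    discrD B.a B.b B.c B.d = 0 ∧ B.b ^ 2 ≠ 3 * B.a * B.c ∧
      rootRs B.a B.b B.c B.d ≤ B.w ∧ B.w < rootRd B.a B.b B.c B.d := by
  constructor
  · rintro ⟨g, hg, hmax⟩
    obtain ⟨α, β, rfl⟩ := h.exists_eq g hg
    exact (h.isDouble_of_isLocalExtrOn (Or.inr hmax.localize)).roots
  · rintro ⟨hD, hne, -, hw⟩
    exact ⟨φ 0 _, h.mem _ _, h.isMaxOn (B.isDouble_log_rootRd hD hne hw)⟩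

end IsParam

end Critical

/-! ### The parametrization of the metrics with `tr_g T = 0` -/

section Parametrization

variable {L : Type*} [LieRing L] [LieAlgebra ℝ L] {𝔨 : LieSubalgebra ℝ L}
  {𝔣 : Fin 2 → LieIdeal ℝ 𝔨}

/-- The metrics with `tr_g T = 0`. -/
def AdaptedBasis.paramMetric (e : AdaptedBasis 𝔣) (B : BlockData) (α β : ℝ) : InvMetric L :=
  e.blockMetric (Real.exp_pos α) (B.y_pos α β)

theorem AdaptedBasis.isDiag_paramMetric (e : AdaptedBasis 𝔣) (B : BlockData) (α β : ℝ) :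
    e.IsDiag (e.paramMetric B α β).form (Real.exp α) (B.y α β) :=
  e.isDiag_blockForm _ _

theorem AdaptedBasis.paramMetric_form (e : AdaptedBasis 𝔣) (B : BlockData) (α β : ℝ) (X Y : L) :
    (e.paramMetric B α β).form X Y = ∑ i, blockWeight (Real.exp α) (B.y α β) (blockOf i) *
      (e.basis.repr X i * e.basis.repr Y i) :=
  e.blockForm_apply _ _ X Y

theorem BlockData.contDiff_blockWeight (B : BlockData) {f g : ℝ → ℝ} (hf : ContDiff ℝ ∞ f)
    (hg : ContDiff ℝ ∞ g) (o : Option (Fin 2)) :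
    ContDiff ℝ ∞ fun t => blockWeight (Real.exp (f t)) (B.y (f t) (g t)) o := by
  rcases o with _ | i
  · exact hf.exp
  · fin_cases i
    · exact (hf.exp.mul contDiff_const).mul ((contDiff_const.mul hg.neg.exp).add contDiff_const)
    · exact hf.exp.mul (contDiff_const.add hg.exp)

theorem BlockData.continuous_blockWeight (B : BlockData) {f g : ℝ → ℝ} (hf : Continuous f)
    (hg : Continuous g) (o : Option (Fin 2)) :
    Continuous fun t => blockWeight (Real.exp (f t)) (B.y (f t) (g t)) o := by
  rcases o with _ | i
  · exact hf.rexp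
  · fin_cases i
    · exact (hf.rexp.mul continuous_const).mul
        ((continuous_const.mul hg.neg.rexp).add continuous_const)
    · exact hf.rexp.mul (continuous_const.add hg.rexp)

theorem BlockData.blockWeight_scale (B : BlockData) (α α' β : ℝ) (o : Option (Fin 2)) :
    blockWeight (Real.exp α') (B.y α' β) o =
      Real.exp (α' - α) * blockWeight (Real.exp α) (B.y α β) o := by
  have h : Real.exp α' = Real.exp (α' - α) * Real.exp α := by
    rw [← Real.exp_add, sub_add_cancel]
  rcases o with _ | i
  · exact h
  · fin_cases i
    · change Real.exp α' * _ * _ = Real.exp (α' - α) * (Real.exp α * _ * _)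
      rw [h]
      ring
    · change Real.exp α' * _ = Real.exp (α' - α) * (Real.exp α * _)
      rw [h]
      ring

theorem InvMetric.ext_form {g h : InvMetric L} (hgh : g.form = h.form) : g = h := by
  cases g
  cases h
  simpa using hgh

variable [FiniteDimensional ℝ L]

theorem AdaptedBasis.isParam (e : AdaptedBasis 𝔣) (h𝔣 : IsIdealDecomposition 𝔨 𝔣)
    (hC : IsCartanDecomposition 𝔨) (hL : LieAlgebra.IsSimple ℝ L) {κ : Fin 2 → ℝ}
    (hκ : ∀ i, ∀ X Y : 𝔣 i,
      killingForm ℝ (𝔣 i) X Y = κ i * killingForm ℝ L (X : 𝔨) (Y : 𝔨))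
    {T : LinearMap.BilinForm ℝ L} (B : BlockData)
    (hT : HasBlockForm 𝔣 T (-B.Tp) ![B.T₁, B.T₂])
    (hn : B.n = Module.finrank ℝ (complP 𝔨)) (hd₁ : B.d₁ = Module.finrank ℝ (𝔣 0))
    (hd₂ : B.d₂ = Module.finrank ℝ (𝔣 1)) (hκ₁ : B.κ₁ = κ 0) (hκ₂ : B.κ₂ = κ 1) :
    IsParam B InvMetric.scal (metricsMT0 𝔨 T) (e.paramMetric B) where
  mem α β := by
    have hd := e.isDiag_paramMetric B α β
    refine ⟨hd.mem_metricsMK h𝔣 hC (Real.exp_pos α).ne', ?_⟩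
    rw [e.tr_eq hd (Real.exp_pos α) (B.y_pos α β) (e.isDiag_of_hasBlockForm hT),
      Fin.sum_univ_two, ← hn, ← hd₁, ← hd₂]
    exact B.tr_param α β
  exists_eq g hg := by
    obtain ⟨x, y, hx, hy, hd⟩ := (e.mem_metricsMK_iff h𝔣 hC hL g).1 hg.1
    have htr := hg.2
    rw [e.tr_eq hd hx hy (e.isDiag_of_hasBlockForm hT), Fin.sum_univ_two, ← hn, ← hd₁,
      ← hd₂] at htr
    obtain ⟨α, β, rfl, rfl⟩ := B.exists_param hx hy htr
    exact ⟨α, β, InvMetric.ext_form hd.eq_blockForm⟩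
  value α β := by
    rw [e.scal_eq h𝔣 hC hκ (e.isDiag_paramMetric B α β) (Real.exp_pos α) (B.y_pos α β),
      Fin.sum_univ_two, ← hn, ← hd₁, ← hd₂, ← hκ₁, ← hκ₂]
    exact B.scal_param α β
  continuous f g hf hg := by
    refine continuous_induced_rng.2 (continuous_pi fun X => continuous_pi fun Y => ?_)
    simp only [Function.comp_apply, e.paramMetric_form]
    exact continuous_finsetSum _ fun i _ =>
      (B.continuous_blockWeight hf hg _).mul continuous_const
  contDiff f g hf hg X Y := by
    simp only [e.paramMetric_form]
    exact ContDiff.sum fun i _ => (B.contDiff_blockWeight hf hg _).mul contDiff_const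
  form_eq α α' β X Y := by
    simp only [e.paramMetric_form, Finset.mul_sum]
    refine Finset.sum_congr rfl fun i _ => ?_
    rw [B.blockWeight_scale α α' β, mul_assoc]

end Parametrization

/-- The classification of the critical points for a simple Lie algebra with a Cartan
decomposition. -/
theorem scal_criticalPoints {L : Type*} [LieRing L] [LieAlgebra ℝ L] [FiniteDimensional ℝ L]
    (hL : LieAlgebra.IsSimple ℝ L) {𝔨 : LieSubalgebra ℝ L} (hC : IsCartanDecomposition 𝔨)
    {𝔣 : Fin 2 → LieIdeal ℝ 𝔨} (h𝔣 : IsIdealDecomposition 𝔨 𝔣)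
    {Tp T₁ T₂ : ℝ} (hTp : 0 < Tp) (hT₁ : 0 < T₁) (hT₂ : 0 < T₂)
    {T : LinearMap.BilinForm ℝ L} (hT : HasBlockForm 𝔣 T (-Tp) ![T₁, T₂]) :
    ∃ κ : Fin 2 → ℝ,
      (∀ i, ∀ X Y : 𝔣 i, killingForm ℝ (𝔣 i) X Y =
        κ i * killingForm ℝ L (X : 𝔨) (Y : 𝔨)) ∧
      ∃ B : BlockData, B.n = Module.finrank ℝ (complP 𝔨) ∧ B.d₁ = Module.finrank ℝ (𝔣 0) ∧
        B.d₂ = Module.finrank ℝ (𝔣 1) ∧ B.κ₁ = κ 0 ∧ B.κ₂ = κ 1 ∧ B.Tp = Tp ∧ B.T₁ = T₁ ∧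
        B.T₂ = T₂ ∧ ∃ φ : ℝ → ℝ → InvMetric L, IsParam B InvMetric.scal (metricsMT0 𝔨 T) φ := by
  have hp := hC.complP_ne_bot hL h𝔣 (zero_ne_one (α := Fin 2))
  obtain ⟨κ, hκ⟩ := h𝔣.exists_killingForm_eq_mul hC hL hp
  obtain ⟨e⟩ := exists_adaptedBasis hC h𝔣
  have hlt := AdaptedBasis.kappa_lt_one h𝔣 hC hL hp hκ
  have := Submodule.nontrivial_iff_ne_bot.2 hp
  have := h𝔣.nontrivial 0
  have := h𝔣.nontrivial 1
  let B : BlockData :=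
    { n := Module.finrank ℝ (complP 𝔨)
      d₁ := Module.finrank ℝ (𝔣 0)
      d₂ := Module.finrank ℝ (𝔣 1)
      κ₁ := κ 0
      κ₂ := κ 1
      Tp := Tp
      T₁ := T₁
      T₂ := T₂
      n_pos := Nat.cast_pos.2 Module.finrank_pos
      d₁_pos := Nat.cast_pos.2 Module.finrank_pos
      d₂_pos := Nat.cast_pos.2 Module.finrank_pos
      κ₁_lt := hlt 0
      κ₂_lt := hlt 1
      Tp_pos := hTp
      T₁_pos := hT₁
      T₂_pos := hT₂ }
  exact ⟨κ, hκ, B, rfl, rfl, rfl, rfl, rfl, rfl, rfl, rfl, _,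
    e.isParam h𝔣 hC hL hκ B hT rfl rfl rfl rfl rfl⟩

end NatRed

end

/-! ### The classification for the Lie group -/

theorem mainTheorem8
    {N : ℕ} {G : Type*} [TopologicalSpace G] [ChartedSpace (EuclideanSpace ℝ (Fin N)) G]
    [Group G] [LieGroup (𝓡 N) ∞ G] [T2Space G] [ConnectedSpace G] [NoncompactSpace G]
    (hG : LieAlgebra.IsSimple ℝ (GroupLieAlgebra (𝓡 N) G))
    (K : Subgroup G) (hK : NatRed.IsMaximalCompact K)
    (𝔨 : LieSubalgebra ℝ (GroupLieAlgebra (𝓡 N) G)) (h𝔨 : NatRed.IsLieAlgebraOf 𝔨 K)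
    (hCartan : NatRed.IsCartanDecomposition 𝔨)
    (𝔣 : Fin 2 → LieIdeal ℝ 𝔨) (h𝔣 : NatRed.IsIdealDecomposition 𝔨 𝔣)
    (Tp T₁ T₂ : ℝ) (hTp : 0 < Tp) (hT₁ : 0 < T₁) (hT₂ : 0 < T₂)
    (T : LinearMap.BilinForm ℝ (GroupLieAlgebra (𝓡 N) G))
    (hT : NatRed.HasBlockForm 𝔣 T (-Tp) ![T₁, T₂]) :
    ∃ κ : Fin 2 → ℝ,
      (∀ i, ∀ X Y : 𝔣 i, killingForm ℝ (𝔣 i) X Y =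
        κ i * killingForm ℝ (GroupLieAlgebra (𝓡 N) G) (X : 𝔨) (Y : 𝔨)) ∧
      ∀ n d₁ d₂ a b c d D Rt Rd Rs : ℝ,
      n = Module.finrank ℝ (NatRed.complP 𝔨) →
      d₁ = Module.finrank ℝ (𝔣 0) →
      d₂ = Module.finrank ℝ (𝔣 1) →
      a = n * d₂ * (1 - κ 1) * Tp →
      b = d₁ ^ 2 * (1 - κ 0) * T₁ - d₂ ^ 2 * (1 - κ 1) * T₂ + 2 * n ^ 2 * Tp
        - n ^ 2 * κ 0 * Tp ^ 2 / T₁ →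
      c = -2 * n * d₂ * T₂ + 2 * n * d₂ * κ 0 * Tp * T₂ / T₁ - n * d₂ * κ 1 * Tp →
      d = -(d₂ ^ 2 * κ 0 * T₂ ^ 2 / T₁) + κ 1 * d₂ ^ 2 * T₂ →
      D = NatRed.discrD a b c d →
      Rt = NatRed.rootRt a b →
      Rd = NatRed.rootRd a b c d →
      Rs = NatRed.rootRs a b c d →
      ∀ (S : NatRed.InvMetric (GroupLieAlgebra (𝓡 N) G) → ℝ)
        (M : Set (NatRed.InvMetric (GroupLieAlgebra (𝓡 N) G))),
      S = NatRed.InvMetric.scal → M = NatRed.metricsMT0 𝔨 T →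
      (¬ ∃ g ∈ M, IsMinOn S M g) ∧
      ((∃ g ∈ M, NatRed.IsSaddlePointOn S M g) ↔
        D = 0 ∧ b ^ 2 = 3 * a * c ∧ d₂ * T₂ / (n * Tp) < Rt) ∧
      ((∃ g ∈ M, IsMaxOn S M g) ↔
        D = 0 ∧ b ^ 2 ≠ 3 * a * c ∧ Rs ≤ d₂ * T₂ / (n * Tp) ∧ d₂ * T₂ / (n * Tp) < Rd) ∧
      ((∃ g ∈ M, IsLocalMaxOn S M g ∧ ¬ IsMaxOn S M g) ↔
        D = 0 ∧ b ^ 2 ≠ 3 * a * c ∧ d₂ * T₂ / (n * Tp) < Rs ∧ Rs < Rd) ∧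
      ((∃ g ∈ M, IsLocalMinOn S M g) ↔
        D = 0 ∧ b ^ 2 ≠ 3 * a * c ∧ d₂ * T₂ / (n * Tp) < Rd ∧ Rd < Rs) ∧
      (∀ g h, NatRed.IsCriticalPointOn S M g → NatRed.IsCriticalPointOn S M h →
        ∃ s : ℝ, 0 < s ∧ ∀ X Y, h.form X Y = s * g.form X Y) := by
  obtain ⟨κ, hκ, B, hn, hd₁, hd₂, hκ₁, hκ₂, hBp, hB₁, hB₂, φ, h⟩ :=
    NatRed.scal_criticalPoints hG hCartan h𝔣 hTp hT₁ hT₂ hT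
  refine ⟨κ, hκ, ?_⟩
  intro n d₁ d₂ a b c d D Rt Rd Rs en ed₁ ed₂ ea eb ec ed eD eRt eRd eRs S M eS eM
  rw [← hn] at en
  rw [← hd₁] at ed₁
  rw [← hd₂] at ed₂
  rw [← hκ₁, ← hκ₂] at eb
  rw [← hκ₂] at ea
  rw [← hκ₁, ← hκ₂] at ec ed
  subst hBp hB₁ hB₂ en ed₁ ed₂
  obtain rfl : a = B.a := ea
  obtain rfl : b = B.b := eb
  obtain rfl : c = B.c := ec
  obtain rfl : d = B.d := ed
  subst eD eRt eRd eRs eS eM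
  change (¬ ∃ g ∈ _, _) ∧ (_ ↔ _ ∧ _ ∧ B.w < _) ∧ (_ ↔ _ ∧ _ ∧ _ ≤ B.w ∧ B.w < _) ∧
    (_ ↔ _ ∧ _ ∧ B.w < _ ∧ _) ∧ (_ ↔ _ ∧ _ ∧ B.w < _ ∧ _) ∧ _
  -- In the equivalences for saddles, proper local maxima and local minima both sides are false, so
  -- each direction is a contradiction.
  refine ⟨fun ⟨g, _, hg⟩ => h.not_isMinOn g hg, ⟨?_, ?_⟩, h.exists_isMaxOn_iff, ⟨?_, ?_⟩,
    ⟨?_, ?_⟩, fun g g' => h.exists_smul_of_isCriticalPointOn⟩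
  · rintro ⟨g, hg, hs⟩
    obtain ⟨α, β, rfl⟩ := h.exists_eq g hg
    exact absurd hs h.not_isSaddlePointOn
  · rintro ⟨hD, hb, hw⟩
    -- A triple root to the right of `w` is incompatible with `P(w) > 0`.
    exact absurd B.P_w_pos (not_lt.2 (NatRed.cubic_nonpos_of_lt_rootRt B.a_pos hD hb hw))
  · rintro ⟨g, hg, hmax, hnot⟩
    obtain ⟨α, β, rfl⟩ := h.exists_eq g hg
    exact absurd (h.isMaxOn (h.isDouble_of_isLocalExtrOn (Or.inr hmax))) hnot
  · rintro ⟨hD, hb, hw, -⟩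
    exact absurd hw (B.rootRs_lt hD hb).not_gt
  · rintro ⟨g, hg, hmin⟩
    obtain ⟨α, β, rfl⟩ := h.exists_eq g hg
    exact absurd hmin h.not_isLocalMinOn
  · rintro ⟨hD, hb, hw, hlt⟩
    exact absurd (hw.trans hlt) (B.rootRs_lt hD hb).not_gt
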